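/- Let $0<r<1/2$, $0<2\omega<1-2r$ and $s=\frac{r}{2-4r-2\omega}$. Let $\phi_j$, $j\ge 1$, be a complete orthonormal system in $L_2(0,1)$. One observes $dY_\varepsilon(t)=S(t)\,dt+\varepsilon\,dw(t)$, $t\in(0,1)$, where $dw$ is Gaussian white noise; put $y_{\varepsilon j}=\int_0^1\phi_j\,dY_\varepsilon$ and $$T_\varepsilon=\varepsilon^{-2}\sum_{j\ge1}\varkappa_{\varepsilon j}^2y_{\varepsilon j}^2-\rho_\varepsilon^2,\qquad \rho_\varepsilon^2=\sum_{j\ge1}\varkappa_{\varepsilon j}^2<\infty ,\qquad A_\varepsilon=\varepsilon^{-4}\sum_{j\ge1}\varkappa_{\varepsilon j}^4 .$$ Put $k_\varepsilon=\sup\{k:\sum_{j<k}\varkappa_{\varepsilon j}^2\le\tfrac12\rho_\varepsilon^2\}$, $\varkappa_\varepsilon^2=\varkappa^2_{\varepsilon k_\varepsilon}$, and assume: A1. For each $\varepsilon>0$ the sequence $j\mapsto\varkappa_{\varepsilon j}^2$ is non-increasing. A2. There are constants $0<C_1<C_2$ with $C_1<A_\varepsilon<C_2$ for all $\varepsilon>0$.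 A3. There are $C>0$ and $\lambda>1$ such that $\varkappa^2_{\varepsilon,[(1+\delta)k_\varepsilon]}<C(1+\delta)^{-\lambda}\varkappa_\varepsilon^2$ for all $\delta>0$, $\varepsilon>0$. A4. $\varkappa_{\varepsilon1}^2\asymp\varkappa_\varepsilon^2$ as $\varepsilon\to0$, and for every $c>1$ there is $C>0$ with $\varkappa^2_{\varepsilon,[ck_\varepsilon]}\ge C\varkappa_\varepsilon^2$ for all $\varepsilon>0$. Assume also $k_\varepsilon\asymp\varepsilon^{-4+8r+4\omega}$ as $\varepsilon\to0$. For the tests $L_{\varepsilon}=\mathbf 1\{A_\varepsilon^{-1/2}T_\varepsilon>x_\varepsilon\}$ let $\alpha(L_\varepsilon)=\mathbf E_0L_\varepsilon$ and $\beta(L_\varepsilon,S)=\mathbf E_S(1-L_\varepsilon)$. For $R_\varepsilon\to\infty$, alternatives $S_\varepsilon$ observed at noise level $\varepsilon$ (a family with $\varepsilon\to0$, or a sequence with $\varepsilon=\varepsilon_n\to0$) are called $R_\varepsilon$-LD consistent if, for every choice of the critical values $x_\varepsilon$ with $R_\varepsilon^{-2}\log\alpha(L_\varepsilon)\to0$,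 there is $C$ with $R_\varepsilon^2\le C\,|\log\beta(L_\varepsilon,S_\varepsilon)|$ in the limit (i.e. for all small $\varepsilon$, respectively all large $n$; $|\log0|=\infty$). Otherwise they are called $R_\varepsilon$-LD inconsistent. For $P_0>0$ let $U=\bar{\mathbb B}^s_{2\infty}(P_0)$ be the set of $S=\sum_j\theta_j\phi_j\in L_2(0,1)$ with $\sup_{\lambda>0}\lambda^{2s}\sum_{j>\lambda}\theta_j^2\le P_0$, and let $\Xi=\bar{\mathbb B}^s_{2\infty}$ be the set of those for which this supremum is finite. Then, for every $P_0>0$, $U$ is a maxiset and $\Xi$ a maxispace for the statistics $T_\varepsilon$. That is: $U$ is convex, centrally symmetric and compact in $L_2(0,1)$, with linear span $\Xi$ (so it is the unit ball of a norm that makes $\Xi$ a Banach space); the functions $e_i=\sqrt{P_0}\,i^{-s}\phi_i\in U$, $i\ge1$, form a greedy system of $U$, which means that, with $\Pi_i=\operatorname{span}(e_1,\dots,e_i)$ and $\Pi_0=\{0\}$, the function $e_i$ has the largest $L_2$-distance from $\Pi_{i-1}$ among all elements of $U$; and, with $\tilde S_i$ the difference of $S$ and its orthogonal projection on $\Pi_i$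 (that is, $\tilde S_i=\sum_{j>i}\theta_j\phi_j$): (i) every family $S_\varepsilon\in U$ with $\|S_\varepsilon\|\asymp\varepsilon^{2r}$ as $\varepsilon\to0$ is $\varepsilon^{-2\omega}$-LD consistent; (ii) for every $S\in L_2(0,1)$ with $S\notin\Xi$ there are sequences of natural numbers $i_n\to\infty$, $j_n\to\infty$ and constants $0<c<C$ such that $c\,j_n^{-r}<\|\tilde S_{i_n}\|<C\,j_n^{-r}$ for all $n$, and the sequence of alternatives $\tilde S_{i_n}$, observed at noise level $\varepsilon_n=j_n^{-1/2}$, is $j_n^{\omega}$-LD inconsistent. -/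

import Mathlib

open MeasureTheory ProbabilityTheory Filter Topology Asymptotics

noncomputable section

namespace SignalDetection

/-- The real Hilbert space `L₂(0,1)`. -/
abbrev L2 : Type := Lp ℝ 2 (volume.restrict (Set.Ioo (0 : ℝ) 1))

/-! ### Observations and test statistics

Throughout, the basis `b : HilbertBasis ℕ ℝ L2` is numbered from `0`, so `b j` is `φ_{j+1}`.
The weights `ϰ ε j` are numbered as in the text, from `j = 1`; `ϰ ε 0` is never used. -/

/-- Gaussian white noise `dw` on `(0,1)`: `W f` is the stochastic integral `∫₀¹ f dw`, i.e. `W` is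
the centred Gaussian process indexed by `L₂(0,1)` whose covariance is the inner product. -/
structure IsGaussianWhiteNoise {Ω : Type*} [MeasurableSpace Ω] (μ : Measure Ω)
    (W : L2 → Ω → ℝ) : Prop where
  gaussian : IsGaussianProcess W μ
  mean_zero : ∀ f, ∫ x, W f x ∂μ = 0
  covariance_eq : ∀ f g, cov[W f, W g; μ] = inner ℝ f g

/-- The observation `∫₀¹ f dY_ε`, where `dY_ε = S dt + ε dw`. -/
def observation {Ω : Type*} (W : L2 → Ω → ℝ) (ε : ℝ) (S f : L2) (x : Ω) : ℝ :=
  inner ℝ f S + ε * W f x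

/-- `ρ_ε² = ∑_{j ≥ 1} ϰ²_{εj}`. -/
def rhoSq (ϰ : ℝ → ℕ → ℝ) (ε : ℝ) : ℝ := ∑' j : ℕ, ϰ ε (j + 1) ^ 2

/-- `A_ε = ε⁻⁴ ∑_{j ≥ 1} ϰ⁴_{εj}`. -/
def bigA (ϰ : ℝ → ℕ → ℝ) (ε : ℝ) : ℝ := (ε ^ 4)⁻¹ * ∑' j : ℕ, ϰ ε (j + 1) ^ 4

/-- `k_ε = sup {k : ∑_{1 ≤ j < k} ϰ²_{εj} ≤ ρ_ε² / 2}`. -/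
def kEps (ϰ : ℝ → ℕ → ℝ) (ε : ℝ) : ℕ :=
  sSup {k : ℕ | ∑ j ∈ Finset.Ico 1 k, ϰ ε j ^ 2 ≤ rhoSq ϰ ε / 2}

/-- `ϰ_ε² = ϰ²_{ε, k_ε}`. -/
def kappaSq (ϰ : ℝ → ℕ → ℝ) (ε : ℝ) : ℝ := ϰ ε (kEps ϰ ε) ^ 2

/-- Conditions A1–A4 on the weights `ϰ²_{εj}`, together with the convergence of the series
`ρ_ε² = ∑ ϰ²_{εj}`, without which the test statistic is not defined. -/
structure WeightConditions (ϰ : ℝ → ℕ → ℝ) : Prop where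
  summable : ∀ ε > 0, Summable fun j : ℕ => ϰ ε (j + 1) ^ 2
  A1 : ∀ ε > 0, ∀ j ≥ 1, ϰ ε (j + 1) ^ 2 ≤ ϰ ε j ^ 2
  A2 : ∃ C₁ > 0, ∃ C₂ > 0, ∀ ε > 0, C₁ < bigA ϰ ε ∧ bigA ϰ ε < C₂
  A3 : ∃ C₁ > 0, ∃ lam > (1 : ℝ), ∀ δ > (0 : ℝ), ∀ ε > 0,
    ϰ ε ⌊(1 + δ) * (kEps ϰ ε : ℝ)⌋₊ ^ 2 < C₁ * (1 + δ) ^ (-lam) * kappaSq ϰ ε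
  A4_first : (fun ε => ϰ ε 1 ^ 2) =Θ[𝓝[>] 0] kappaSq ϰ
  A4 : ∀ c > (1 : ℝ), ∃ C > 0, ∀ ε > 0,
    C * kappaSq ϰ ε ≤ ϰ ε ⌊c * (kEps ϰ ε : ℝ)⌋₊ ^ 2

section Tests

variable {Ω : Type*} [MeasurableSpace Ω]

/-- The Neyman type statistic `T_ε(Y_ε) = ε⁻² ∑_j ϰ²_{εj} y²_{εj} - ρ_ε²`, `y_{εj} = ∫ φ_j dY_ε`,
when the signal is `S`. -/
def neymanStat (W : L2 → Ω → ℝ) (b : HilbertBasis ℕ ℝ L2) (ϰ : ℝ → ℕ → ℝ)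
    (ε : ℝ) (S : L2) (x : Ω) : ℝ :=
  (ε ^ 2)⁻¹ * ∑' j : ℕ, ϰ ε (j + 1) ^ 2 * observation W ε S (b j) x ^ 2 - rhoSq ϰ ε

/-- The type I error probability of the test `1{A_ε^{-1/2} T_ε > t}`. -/
def typeIError (μ : Measure Ω) (W : L2 → Ω → ℝ) (b : HilbertBasis ℕ ℝ L2) (ϰ : ℝ → ℕ → ℝ)
    (ε t : ℝ) : ENNReal :=
  μ {x | (√(bigA ϰ ε))⁻¹ * neymanStat W b ϰ ε 0 x > t}

/-- The type II error probability, at the alternative `S`, of the test `1{A_ε^{-1/2} T_ε > t}`. -/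
def typeIIError (μ : Measure Ω) (W : L2 → Ω → ℝ) (b : HilbertBasis ℕ ℝ L2) (ϰ : ℝ → ℕ → ℝ)
    (ε t : ℝ) (S : L2) : ENNReal :=
  μ {x | ¬ (√(bigA ϰ ε))⁻¹ * neymanStat W b ϰ ε S x > t}

/-- LD consistency with rate `R` of the alternatives `S i`, observed at noise level `ε i`, along
the filter `l`: for all critical values `t i` such that `R⁻² log α → 0`, one has
`|log β| = Ω(R²)`. Logarithms take values in `[-∞, ∞]`, so `|log 0| = ∞`. The index `i` is the noise
level itself for families `(S_ε)`, `ε → 0`, and `n → ∞` for sequences. -/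
def IsLDConsistent (μ : Measure Ω) (W : L2 → Ω → ℝ) (b : HilbertBasis ℕ ℝ L2) (ϰ : ℝ → ℕ → ℝ)
    {ι : Type*} (l : Filter ι) (ε : ι → ℝ) (S : ι → L2) (R : ι → ℝ) : Prop :=
  ∀ t : ι → ℝ,
    Tendsto (fun i => (((R i ^ 2)⁻¹ : ℝ) : EReal) * ENNReal.log (typeIError μ W b ϰ (ε i) (t i)))
      l (𝓝 0) →
    ∃ C > (0 : ℝ), ∀ᶠ i in l, ENNReal.ofReal (R i ^ 2) ≤
      ENNReal.ofReal C * (ENNReal.log (typeIIError μ W b ϰ (ε i) (t i) (S i))).abs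

end Tests

/-! ### Besov type balls -/

/-- The ball `B̄^s_{2∞}(P₀)`: `sup_{λ>0} λ^{2s} ∑_{j>λ} θ_j² ≤ P₀` for the Fourier coefficients
`θ_j` of `S` in the basis. -/
def besovBall (b : HilbertBasis ℕ ℝ L2) (s P₀ : ℝ) : Set L2 :=
  {S | ∀ lam > (0 : ℝ), lam ^ (2 * s) *
    ∑' j : ℕ, (if lam < (j : ℝ) + 1 then (inner ℝ (b j) S : ℝ) ^ 2 else 0) ≤ P₀}

/-- The space `B̄^s_{2∞}`: the supremum over `λ` is finite. -/
def besovSpace (b : HilbertBasis ℕ ℝ L2) (s : ℝ) : Set L2 :=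
  {S | ∃ P : ℝ, S ∈ besovBall b s P}

/-! ### Maxisets -/

/-- The subspace `Π_i` spanned by the first `i` functions of the sequence `e`. -/
def greedySpan (e : ℕ → L2) (i : ℕ) : Submodule ℝ L2 :=
  Submodule.span ℝ (Set.range fun k : Fin i => e k)

instance (e : ℕ → L2) (i : ℕ) : FiniteDimensional ℝ (greedySpan e i) :=
  FiniteDimensional.span_of_finite ℝ (Set.finite_range _)

/-- `e` is a system of functions of `U` chosen inductively: `e i` (the `(i+1)`-st function) has the
largest distance from `Π_i` among the elements of `U`. For `i = 0` this is the largest norm. -/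
def IsGreedySystem (U : Set L2) (e : ℕ → L2) : Prop :=
  ∀ i, e i ∈ U ∧ ∀ S ∈ U,
    Metric.infDist S (greedySpan e i : Set L2) ≤ Metric.infDist (e i) (greedySpan e i : Set L2)

/-- The residual `S̃_i = S - S_{Π_i}`. -/
def greedyResidual (e : ℕ → L2) (S : L2) (i : ℕ) : L2 :=
  S - (greedySpan e i).starProjection S

/-- `U` is a maxiset and `Ξ` is a maxispace for the statistics `T_ε`, with the functions `e` chosen
in the inductive construction of the subspaces `Π_i`. The first four fields say that `U` is the
unit ball of a Banach space with underlying set `Ξ`, compact in `L₂(0,1)` (the gauge of a compact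
convex symmetric set is a complete norm on its span, and the set is its closed unit ball). -/
structure IsMaxiset {Ω : Type*} [MeasurableSpace Ω] (μ : Measure Ω) (W : L2 → Ω → ℝ)
    (b : HilbertBasis ℕ ℝ L2) (ϰ : ℝ → ℕ → ℝ) (r ω : ℝ) (U Ξ : Set L2) (e : ℕ → L2) : Prop where
  convex : Convex ℝ U
  symmetric : ∀ S ∈ U, -S ∈ U
  compact : IsCompact U
  span_eq : (Submodule.span ℝ U : Set L2) = Ξ
  greedy : IsGreedySystem U e
  /-- Property i. -/
  consistent : ∀ S : ℝ → L2, (∀ᶠ ε in 𝓝[>] 0, S ε ∈ U) →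
    (fun ε => ‖S ε‖) =Θ[𝓝[>] 0] (fun ε : ℝ => ε ^ (2 * r)) →
    IsLDConsistent μ W b ϰ (𝓝[>] 0) (fun ε : ℝ => ε) S (fun ε : ℝ => ε ^ (-(2 * ω)))
  /-- Property ii. -/
  inconsistent : ∀ S : L2, S ∉ Ξ → ∃ i j : ℕ → ℕ,
    Tendsto i atTop atTop ∧ Tendsto j atTop atTop ∧
    (∃ c > 0, ∃ C > 0, ∀ n, c * (j n : ℝ) ^ (-r) < ‖greedyResidual e S (i n)‖ ∧
      ‖greedyResidual e S (i n)‖ < C * (j n : ℝ) ^ (-r)) ∧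
    ¬ IsLDConsistent μ W b ϰ atTop (fun n => (j n : ℝ) ^ (-(1 / 2 : ℝ)))
      (fun n => greedyResidual e S (i n)) (fun n => (j n : ℝ) ^ ω)

end SignalDetection

end

noncomputable section

namespace SignalDetection

/-!
Up to scaling, `T_ε` is a centred weighted sum of noncentral `χ²` variables. Write
`σ_ε = (∑ ϰ⁴_{εj})^{1/2}`; the largest weight `ϰ²_{ε1}` is small compared with `σ_ε`. Chernoff's
bound and, conversely, the Paley–Zygmund inequality for exponential moments show that
`|log α| ≍ y²` for the type I error `α` at a moderate deviation threshold `y σ_ε`. Hence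
consistency with rate `R` amounts to comparing the drift `ε⁻² ∑ ϰ²_{εj} θ_j²` with `R σ_ε`, and for
the given exponents `R σ_ε` is of the order `ϰ_ε² (ε^{2r} / ε)²`: the drift of a signal of norm
`ε^{2r}` whose energy sits where `ϰ²_{εj} ≍ ϰ_ε²`. For signals in the Besov ball a fixed fraction
of the energy lies in the first `c k_ε` coordinates, where this is the case. Outside the Besov
space there are residuals of norm of order `ε^{2r}` starting at some `i ≫ k_ε`, where
`ϰ²_{εj} = o(ϰ_ε²)`, and their drift is negligible.
-/

section ChiSquare

variable {Ω : Type*} [MeasurableSpace Ω] {μ : Measure Ω}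

theorem lintegral_exp_mul_add_sq_gaussianReal {c : ℝ} (hc : c < 1 / 2) (h : ℝ) :
    ∫⁻ x, ENNReal.ofReal (Real.exp (c * (x + h) ^ 2)) ∂gaussianReal 0 1 =
      ENNReal.ofReal ((√(1 - 2 * c))⁻¹ * Real.exp (c / (1 - 2 * c) * h ^ 2)) := by
  have hd : 0 < 1 - 2 * c := by linarith
  have hs : √(1 - 2 * c) ≠ 0 := (Real.sqrt_pos.2 hd).ne'
  obtain ⟨v, hv⟩ : ∃ v : NNReal, (v : ℝ) = (1 - 2 * c)⁻¹ := ⟨⟨_, by positivity⟩, rfl⟩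
  have hv0 : v ≠ 0 := by
    rw [← NNReal.coe_ne_zero, hv]
    positivity
  have complete_square (x : ℝ) : -(x - 0) ^ 2 / (2 * 1) + c * (x + h) ^ 2 =
      c / (1 - 2 * c) * h ^ 2 +
        -(x - 2 * c * h / (1 - 2 * c)) ^ 2 / (2 * (1 - 2 * c)⁻¹) := by
    field_simp
    ring
  have density_mul (x : ℝ) :
      (gaussianPDF 0 1 * fun x => ENNReal.ofReal (Real.exp (c * (x + h) ^ 2))) x =
        ENNReal.ofReal ((√(1 - 2 * c))⁻¹ * Real.exp (c / (1 - 2 * c) * h ^ 2)) *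
          gaussianPDF (2 * c * h / (1 - 2 * c)) v x := by
    simp only [Pi.mul_apply, gaussianPDF]
    rw [← ENNReal.ofReal_mul (gaussianPDFReal_nonneg _ _ _), ← ENNReal.ofReal_mul (by positivity)]
    simp only [gaussianPDFReal, hv, NNReal.coe_one]
    rw [mul_assoc, ← Real.exp_add, complete_square, Real.exp_add,
      Real.sqrt_mul' _ (by positivity : (0 : ℝ) ≤ (1 - 2 * c)⁻¹), Real.sqrt_inv]
    congr 1
    field_simp
  rw [gaussianReal_of_var_ne_zero _ one_ne_zero,
    lintegral_withDensity_eq_lintegral_mul _ (measurable_gaussianPDF 0 1) (by fun_prop),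
    lintegral_congr density_mul, lintegral_const_mul _ (measurable_gaussianPDF _ _),
    lintegral_gaussianPDF_eq_one _ hv0, mul_one]

theorem inv_sqrt_one_sub_le_exp {c : ℝ} (hc : c ≤ 1 / 4) :
    (√(1 - 2 * c))⁻¹ ≤ Real.exp (c + 4 * c ^ 2) := by
  have hd : 0 < 1 - 2 * c := by linarith
  have hlog : -(2 * c) - 8 * c ^ 2 ≤ Real.log (1 - 2 * c) := by
    refine le_trans ?_ (Real.one_sub_inv_le_log_of_pos hd)
    have hrem : 1 - (1 - 2 * c)⁻¹ - (-(2 * c) - 8 * c ^ 2) =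
        4 * c ^ 2 * (1 - 4 * c) / (1 - 2 * c) := by
      field_simp
      ring
    have hrem_nonneg : 0 ≤ 4 * c ^ 2 * (1 - 4 * c) / (1 - 2 * c) :=
      div_nonneg (mul_nonneg (by positivity) (by linarith)) hd.le
    linarith
  rw [inv_le_comm₀ (Real.sqrt_pos.2 hd) (Real.exp_pos _), ← Real.exp_neg]
  apply Real.le_sqrt_of_sq_le
  rw [← Real.exp_nat_mul, ← Real.le_log_iff_exp_le hd]
  push_cast
  linarith

theorem exp_le_inv_sqrt_one_sub {c : ℝ} (hc₀ : 0 ≤ c) (hc : c < 1 / 2) :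
    Real.exp (c + c ^ 2) ≤ (√(1 - 2 * c))⁻¹ := by
  have hd : 0 < 1 - 2 * c := by linarith
  have hlog : 2 * c + (2 * c) ^ 2 / 2 ≤ -Real.log (1 - 2 * c) := by
    have hseries := Real.hasSum_pow_div_log_of_abs_lt_one (x := 2 * c)
      (by rw [abs_of_nonneg (by linarith)]; linarith)
    have hpartial := sum_le_hasSum (Finset.range 2) (fun n _ => by positivity) hseries
    norm_num [Finset.sum_range_succ] at hpartial ⊢
    exact hpartial
  rw [le_inv_comm₀ (Real.exp_pos _) (Real.sqrt_pos.2 hd), ← Real.exp_neg,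
    Real.sqrt_le_left (Real.exp_pos _).le, ← Real.exp_nat_mul, ← Real.log_le_iff_le_exp hd]
  push_cast
  linarith

theorem lintegral_exp_centered_sq_gaussianReal {c : ℝ} (hc : c < 1 / 2) (h : ℝ) :
    ∫⁻ x, ENNReal.ofReal (Real.exp (c * ((x + h) ^ 2 - (1 + h ^ 2)))) ∂gaussianReal 0 1 =
      ENNReal.ofReal ((√(1 - 2 * c))⁻¹ * Real.exp (2 * c ^ 2 / (1 - 2 * c) * h ^ 2 - c)) := by
  have hd : 0 < 1 - 2 * c := by linarith
  have hfrac : c / (1 - 2 * c) = c + 2 * c ^ 2 / (1 - 2 * c) := by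
    rw [div_eq_iff hd.ne', add_mul, div_mul_cancel₀ _ hd.ne']
    ring
  have hexponent : c / (1 - 2 * c) * h ^ 2 + -(c * (1 + h ^ 2)) =
      2 * c ^ 2 / (1 - 2 * c) * h ^ 2 - c := by
    rw [hfrac]
    ring
  have hsplit (x : ℝ) : ENNReal.ofReal (Real.exp (c * ((x + h) ^ 2 - (1 + h ^ 2)))) =
      ENNReal.ofReal (Real.exp (c * (x + h) ^ 2)) *
        ENNReal.ofReal (Real.exp (-(c * (1 + h ^ 2)))) := by
    rw [← ENNReal.ofReal_mul (Real.exp_pos _).le, ← Real.exp_add]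
    ring_nf
  simp_rw [hsplit]
  rw [lintegral_mul_const' _ _ ENNReal.ofReal_ne_top, lintegral_exp_mul_add_sq_gaussianReal hc,
    ← ENNReal.ofReal_mul (by positivity), mul_assoc, ← Real.exp_add, hexponent]

theorem lintegral_exp_centered_sq_gaussianReal_le {c : ℝ} (hc : c ≤ 1 / 4) (h : ℝ) :
    ∫⁻ x, ENNReal.ofReal (Real.exp (c * ((x + h) ^ 2 - (1 + h ^ 2)))) ∂gaussianReal 0 1 ≤
      ENNReal.ofReal (Real.exp (4 * (c ^ 2 * (1 + h ^ 2)))) := by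
  rw [lintegral_exp_centered_sq_gaussianReal (by linarith)]
  refine ENNReal.ofReal_le_ofReal ?_
  have hfrac : 2 * c ^ 2 / (1 - 2 * c) ≤ 4 * c ^ 2 := by
    rw [div_le_iff₀ (by linarith)]
    nlinarith [sq_nonneg c]
  calc _ ≤ Real.exp (c + 4 * c ^ 2) * Real.exp (4 * c ^ 2 * h ^ 2 - c) := by
        gcongr
        exact inv_sqrt_one_sub_le_exp hc
    _ = _ := by
        rw [← Real.exp_add]
        ring_nf

theorem le_lintegral_exp_centered_sq_gaussianReal {c : ℝ} (hc₀ : 0 ≤ c) (hc : c < 1 / 2) (h : ℝ) :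
    ENNReal.ofReal (Real.exp (c ^ 2 * (1 + h ^ 2))) ≤
      ∫⁻ x, ENNReal.ofReal (Real.exp (c * ((x + h) ^ 2 - (1 + h ^ 2)))) ∂gaussianReal 0 1 := by
  rw [lintegral_exp_centered_sq_gaussianReal hc]
  refine ENNReal.ofReal_le_ofReal ?_
  have hfrac : c ^ 2 ≤ 2 * c ^ 2 / (1 - 2 * c) := by
    rw [le_div_iff₀ (by linarith)]
    nlinarith [mul_nonneg hc₀ (sq_nonneg c), sq_nonneg c]
  calc _ = Real.exp (c + c ^ 2) * Real.exp (c ^ 2 * h ^ 2 - c) := by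
        rw [← Real.exp_add]
        ring_nf
    _ ≤ _ := by
        gcongr
        exact exp_le_inv_sqrt_one_sub hc₀ hc

theorem lintegral_add_sq_gaussianReal (h : ℝ) :
    ∫⁻ x, ENNReal.ofReal ((x + h) ^ 2) ∂gaussianReal 0 1 = ENNReal.ofReal (1 + h ^ 2) := by
  have hmem : MemLp (fun x : ℝ => x + h) 2 (gaussianReal 0 1) :=
    (memLp_id_gaussianReal (μ := 0) (v := 1) 2).add (memLp_const h)
  have hint : Integrable (fun x : ℝ => x) (gaussianReal 0 1) :=
    (memLp_id_gaussianReal (μ := 0) (v := 1) 2).integrable (by norm_num)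
  have hvar := variance_eq_sub hmem
  rw [variance_add_const (by fun_prop), integral_add hint (integrable_const h),
    variance_fun_id_gaussianReal, integral_id_gaussianReal] at hvar
  rw [← ofReal_integral_eq_lintegral_ofReal hmem.integrable_sq (ae_of_all _ fun _ => sq_nonneg _)]
  congr 1
  simp only [integral_const, probReal_univ, smul_eq_mul, one_mul, zero_add, NNReal.coe_one,
    Pi.pow_apply] at hvar
  linarith

theorem lintegral_prod_of_iIndepFun {ι : Type*} {X : ι → Ω → ENNReal} (hX : iIndepFun X μ)
    (hm : ∀ i, AEMeasurable (X i) μ) (s : Finset ι) :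
    ∫⁻ x, ∏ i ∈ s, X i x ∂μ = ∏ i ∈ s, ∫⁻ x, X i x ∂μ := by
  have hmk (i : ι) : X i =ᵐ[μ] (hm i).mk (X i) := (hm i).ae_eq_mk
  have hprod : (fun x => ∏ i ∈ s, X i x) =ᵐ[μ] fun x => ∏ i ∈ s, (hm i).mk (X i) x := by
    filter_upwards [(eventually_all_finset s).2 fun i _ => hmk i] with x hx
    exact Finset.prod_congr rfl hx
  rw [lintegral_congr_ae hprod, lintegral_prod_eq_prod_lintegral_of_indepFun s _ (hX.congr hmk)
    fun i => (hm i).measurable_mk]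
  exact Finset.prod_congr rfl fun i _ => lintegral_congr_ae (hmk i).symm

theorem lintegral_exp_sum_of_iIndepFun {ι : Type*} {ξ : ι → Ω → ℝ} (hind : iIndepFun ξ μ)
    (hm : ∀ j, AEMeasurable (ξ j) μ) {f : ι → ℝ → ℝ} (hf : ∀ j, Measurable (f j)) (s : Finset ι) :
    ∫⁻ x, ENNReal.ofReal (Real.exp (∑ j ∈ s, f j (ξ j x))) ∂μ =
      ∏ j ∈ s, ∫⁻ x, ENNReal.ofReal (Real.exp (f j (ξ j x))) ∂μ := by
  have hexp (j : ι) : Measurable fun y => ENNReal.ofReal (Real.exp (f j y)) :=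
    (Real.measurable_exp.comp (hf j)).ennreal_ofReal
  simp_rw [Real.exp_sum, ENNReal.ofReal_prod_of_nonneg fun _ _ => (Real.exp_pos _).le]
  exact lintegral_prod_of_iIndepFun (hind.comp _ hexp)
    (fun j => (hexp j).comp_aemeasurable (hm j)) s

/-- The random variables `ξ 0, ξ 1, …` are independent and standard normal. -/
structure IsStdNormalSeq (ξ : ℕ → Ω → ℝ) (μ : Measure Ω) : Prop where
  indep : iIndepFun ξ μ
  hasLaw : ∀ j, HasLaw (ξ j) (gaussianReal 0 1) μ

/-- The weighted noncentral `χ²` sum `∑ a_j (z_j + h_j)²`, centred at the mean it has when the `z_j`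
are standard normal. -/
def centeredChiSq (a h z : ℕ → ℝ) : ℝ :=
  ∑' j, a j * (z j + h j) ^ 2 - ∑' j, a j * (1 + h j ^ 2)

/-- The quantity `∑ a_j² (1 + h_j²)`, which controls the fluctuations of `centeredChiSq a h` in the
way a variance does: it lies between a quarter and a half of the variance. -/
def varianceProxy (a h : ℕ → ℝ) : ℝ := ∑' j, a j ^ 2 * (1 + h j ^ 2)

variable {ξ : ℕ → Ω → ℝ} {a h : ℕ → ℝ}

theorem summable_sq_mul (ha₀ : ∀ j, 0 ≤ a j) (ha : Summable fun j => a j * (1 + h j ^ 2)) :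
    Summable fun j => a j ^ 2 * (1 + h j ^ 2) := by
  have ha_le (j : ℕ) : a j ≤ ∑' i, a i * (1 + h i ^ 2) :=
    (le_mul_of_one_le_right (ha₀ j) (by linarith [sq_nonneg (h j)])).trans
      (ha.le_tsum j fun i _ => mul_nonneg (ha₀ i) (by positivity))
  refine .of_nonneg_of_le (fun j => by positivity) (fun j => ?_)
    (ha.mul_left (∑' i, a i * (1 + h i ^ 2)))
  rw [sq, mul_assoc]
  exact mul_le_mul_of_nonneg_right (ha_le j) (mul_nonneg (ha₀ j) (by positivity))

namespace IsStdNormalSeq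

theorem isProbabilityMeasure (hξ : IsStdNormalSeq ξ μ) : IsProbabilityMeasure μ :=
  hξ.indep.isProbabilityMeasure

theorem aemeasurable (hξ : IsStdNormalSeq ξ μ) (j : ℕ) : AEMeasurable (ξ j) μ :=
  (hξ.hasLaw j).aemeasurable

theorem aemeasurable_centeredChiSq (hξ : IsStdNormalSeq ξ μ) (a h : ℕ → ℝ) :
    AEMeasurable (fun x => centeredChiSq a h (ξ · x)) μ :=
  (AEMeasurable.tsum fun j =>
    (((hξ.aemeasurable j).add_const _).pow_const 2).const_mul _).sub_const _

theorem ae_summable_mul_add_sq (hξ : IsStdNormalSeq ξ μ) (ha₀ : ∀ j, 0 ≤ a j)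
    (ha : Summable fun j => a j * (1 + h j ^ 2)) :
    ∀ᵐ x ∂μ, Summable fun j => a j * (ξ j x + h j) ^ 2 := by
  have hterm₀ (j : ℕ) (x : Ω) : 0 ≤ a j * (ξ j x + h j) ^ 2 := mul_nonneg (ha₀ j) (sq_nonneg _)
  have hmean (j : ℕ) : ∫⁻ x, ENNReal.ofReal (a j * (ξ j x + h j) ^ 2) ∂μ =
      ENNReal.ofReal (a j * (1 + h j ^ 2)) := by
    simp_rw [ENNReal.ofReal_mul (ha₀ j)]
    rw [lintegral_const_mul' _ _ ENNReal.ofReal_ne_top,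
      (hξ.hasLaw j).lintegral_comp (f := fun y => ENNReal.ofReal ((y + h j) ^ 2)) (by fun_prop),
      lintegral_add_sq_gaussianReal]
  have hm (j : ℕ) : AEMeasurable (fun x => ENNReal.ofReal (a j * (ξ j x + h j) ^ 2)) μ :=
    (((hξ.aemeasurable j).add_const _).pow_const 2).const_mul _ |>.ennreal_ofReal
  have hfinite : ∫⁻ x, ∑' j, ENNReal.ofReal (a j * (ξ j x + h j) ^ 2) ∂μ ≠ ⊤ := by
    rw [lintegral_tsum hm]
    simp_rw [hmean]
    exact ha.tsum_ofReal_ne_top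
  filter_upwards [ae_lt_top' (AEMeasurable.tsum hm) hfinite] with x hx
  refine (ENNReal.summable_toReal hx.ne).congr fun j => ?_
  rw [ENNReal.toReal_ofReal (hterm₀ j x)]

theorem lintegral_exp_partialSum (hξ : IsStdNormalSeq ξ μ) (a h : ℕ → ℝ) (u : ℝ) (N : ℕ) :
    ∫⁻ x, ENNReal.ofReal (Real.exp (u * (∑ j ∈ Finset.range N, a j * (ξ j x + h j) ^ 2 -
        ∑ j ∈ Finset.range N, a j * (1 + h j ^ 2)))) ∂μ =
      ∏ j ∈ Finset.range N, ∫⁻ x, ENNReal.ofReal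
        (Real.exp (u * a j * ((x + h j) ^ 2 - (1 + h j ^ 2)))) ∂gaussianReal 0 1 := by
  simp_rw [← Finset.sum_sub_distrib, Finset.mul_sum, ← mul_sub, ← mul_assoc u]
  rw [lintegral_exp_sum_of_iIndepFun (f := fun j y => u * a j * ((y + h j) ^ 2 - (1 + h j ^ 2)))
    hξ.indep hξ.aemeasurable (fun j => by fun_prop)]
  exact Finset.prod_congr rfl fun j _ => (hξ.hasLaw j).lintegral_comp
    (f := fun y => ENNReal.ofReal (Real.exp (u * a j * ((y + h j) ^ 2 - (1 + h j ^ 2)))))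
    (by fun_prop)

theorem lintegral_exp_partialSum_le (hξ : IsStdNormalSeq ξ μ) (h : ℕ → ℝ) {u : ℝ}
    (hu : ∀ j, u * a j ≤ 1 / 4) (N : ℕ) :
    ∫⁻ x, ENNReal.ofReal (Real.exp (u * (∑ j ∈ Finset.range N, a j * (ξ j x + h j) ^ 2 -
        ∑ j ∈ Finset.range N, a j * (1 + h j ^ 2)))) ∂μ ≤
      ENNReal.ofReal (Real.exp
        (4 * u ^ 2 * ∑ j ∈ Finset.range N, a j ^ 2 * (1 + h j ^ 2))) := by
  rw [hξ.lintegral_exp_partialSum, Finset.mul_sum, Real.exp_sum,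
    ENNReal.ofReal_prod_of_nonneg fun _ _ => (Real.exp_pos _).le]
  refine Finset.prod_le_prod' fun j _ => ?_
  refine (lintegral_exp_centered_sq_gaussianReal_le (hu j) (h j)).trans_eq ?_
  ring_nf

theorem le_lintegral_exp_partialSum (hξ : IsStdNormalSeq ξ μ) (h : ℕ → ℝ) {u : ℝ}
    (hu₀ : ∀ j, 0 ≤ u * a j) (hu : ∀ j, u * a j < 1 / 2) (N : ℕ) :
    ENNReal.ofReal (Real.exp (u ^ 2 * ∑ j ∈ Finset.range N, a j ^ 2 * (1 + h j ^ 2))) ≤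
      ∫⁻ x, ENNReal.ofReal (Real.exp (u * (∑ j ∈ Finset.range N, a j * (ξ j x + h j) ^ 2 -
        ∑ j ∈ Finset.range N, a j * (1 + h j ^ 2)))) ∂μ := by
  rw [hξ.lintegral_exp_partialSum, Finset.mul_sum, Real.exp_sum,
    ENNReal.ofReal_prod_of_nonneg fun _ _ => (Real.exp_pos _).le]
  refine Finset.prod_le_prod' fun j _ => ?_
  refine le_of_eq_of_le ?_ (le_lintegral_exp_centered_sq_gaussianReal (hu₀ j) (hu j) (h j))
  ring_nf

/-- The Laplace transforms of the partial sums pass to the limit by Fatou's lemma. -/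
theorem lintegral_exp_mul_centeredChiSq_le (hξ : IsStdNormalSeq ξ μ) (ha₀ : ∀ j, 0 ≤ a j)
    (ha : Summable fun j => a j * (1 + h j ^ 2)) {u : ℝ} (hu : ∀ j, u * a j ≤ 1 / 4) :
    ∫⁻ x, ENNReal.ofReal (Real.exp (u * centeredChiSq a h (ξ · x))) ∂μ ≤
      ENNReal.ofReal (Real.exp (4 * u ^ 2 * varianceProxy a h)) := by
  set F : ℕ → Ω → ENNReal := fun N x => ENNReal.ofReal (Real.exp
    (u * (∑ j ∈ Finset.range N, a j * (ξ j x + h j) ^ 2 -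
      ∑ j ∈ Finset.range N, a j * (1 + h j ^ 2))))
  have hF_meas (N : ℕ) : AEMeasurable (F N) μ :=
    (Real.measurable_exp.comp_aemeasurable (((Finset.aemeasurable_fun_sum _ fun j _ =>
      (((hξ.aemeasurable j).add_const _).pow_const 2).const_mul _).sub_const _).const_mul
        u)).ennreal_ofReal
  have hF_le (N : ℕ) :
      ∫⁻ x, F N x ∂μ ≤ ENNReal.ofReal (Real.exp (4 * u ^ 2 * varianceProxy a h)) := by
    refine (hξ.lintegral_exp_partialSum_le h hu N).trans ?_
    gcongr
    exact (summable_sq_mul ha₀ ha).sum_le_tsum _ fun j _ => by positivity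
  have hF_tendsto : ∀ᵐ x ∂μ, ENNReal.ofReal (Real.exp (u * centeredChiSq a h (ξ · x))) =
      liminf (fun N => F N x) atTop := by
    filter_upwards [hξ.ae_summable_mul_add_sq ha₀ ha] with x hx
    exact (ENNReal.tendsto_ofReal ((Real.continuous_exp.tendsto _).comp
      ((hx.hasSum.tendsto_sum_nat.sub ha.hasSum.tendsto_sum_nat).const_mul u))).liminf_eq.symm
  calc _ = ∫⁻ x, liminf (fun N => F N x) atTop ∂μ := lintegral_congr_ae hF_tendsto
    _ ≤ liminf (fun N => ∫⁻ x, F N x ∂μ) atTop := lintegral_liminf_le' hF_meas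
    _ ≤ _ := liminf_le_of_frequently_le' (Frequently.of_forall hF_le)

theorem le_lintegral_exp_mul_centeredChiSq (hξ : IsStdNormalSeq ξ μ) (ha₀ : ∀ j, 0 ≤ a j)
    (ha : Summable fun j => a j * (1 + h j ^ 2)) {u : ℝ} (hu₀ : 0 ≤ u)
    (hu : ∀ j, u * a j < 1 / 2) :
    ENNReal.ofReal (Real.exp (u ^ 2 * varianceProxy a h)) ≤
      ∫⁻ x, ENNReal.ofReal (Real.exp (u * centeredChiSq a h (ξ · x))) ∂μ := by
  set r : ℕ → ℝ := fun N => ∑' j, a j * (1 + h j ^ 2) - ∑ j ∈ Finset.range N, a j * (1 + h j ^ 2)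
  have hr : Tendsto r atTop (𝓝 0) :=
    sub_self (∑' j, a j * (1 + h j ^ 2)) ▸ ha.hasSum.tendsto_sum_nat.const_sub _
  have hlim : Tendsto (fun N => ENNReal.ofReal (Real.exp
      (u ^ 2 * ∑ j ∈ Finset.range N, a j ^ 2 * (1 + h j ^ 2) - u * r N))) atTop
      (𝓝 (ENNReal.ofReal (Real.exp (u ^ 2 * varianceProxy a h)))) := by
    refine ENNReal.tendsto_ofReal ((Real.continuous_exp.tendsto _).comp ?_)
    simpa only [varianceProxy, mul_zero, sub_zero] using
      ((summable_sq_mul ha₀ ha).hasSum.tendsto_sum_nat.const_mul (u ^ 2)).sub (hr.const_mul u)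
  refine le_of_tendsto' hlim fun N => ?_
  have hpartial : ∀ᵐ x ∂μ, u * (∑ j ∈ Finset.range N, a j * (ξ j x + h j) ^ 2 -
      ∑ j ∈ Finset.range N, a j * (1 + h j ^ 2)) - u * r N ≤ u * centeredChiSq a h (ξ · x) := by
    filter_upwards [hξ.ae_summable_mul_add_sq ha₀ ha] with x hx
    rw [← mul_sub]
    refine mul_le_mul_of_nonneg_left ?_ hu₀
    have := hx.sum_le_tsum (Finset.range N) fun j _ => mul_nonneg (ha₀ j) (sq_nonneg _)
    simp only [r, centeredChiSq]
    linarith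
  calc _ = ENNReal.ofReal (Real.exp
          (u ^ 2 * ∑ j ∈ Finset.range N, a j ^ 2 * (1 + h j ^ 2))) *
            ENNReal.ofReal (Real.exp (-(u * r N))) := by
        rw [← ENNReal.ofReal_mul (Real.exp_pos _).le, ← Real.exp_add, sub_eq_add_neg]
    _ ≤ _ := mul_le_mul_left (hξ.le_lintegral_exp_partialSum h
        (fun j => mul_nonneg hu₀ (ha₀ j)) hu N) _
    _ = _ := (lintegral_mul_const' _ _ ENNReal.ofReal_ne_top).symm
    _ ≤ _ := by
        refine lintegral_mono_ae ?_
        filter_upwards [hpartial] with x hx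
        rw [← ENNReal.ofReal_mul (Real.exp_pos _).le, ← Real.exp_add, ← sub_eq_add_neg]
        gcongr

end IsStdNormalSeq

end ChiSquare

section Tails

variable {Ω : Type*} [MeasurableSpace Ω] {μ : Measure Ω}

theorem measure_ge_le_exp_sub_of_lintegral_exp_le {f : Ω → ℝ} (hf : AEMeasurable f μ) {A : ℝ}
    (hA : ∫⁻ x, ENNReal.ofReal (Real.exp (f x)) ∂μ ≤ ENNReal.ofReal (Real.exp A)) (B : ℝ) :
    μ {x | B ≤ f x} ≤ ENNReal.ofReal (Real.exp (A - B)) := by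
  have hB : ENNReal.ofReal (Real.exp B) ≠ 0 := (ENNReal.ofReal_pos.2 (Real.exp_pos B)).ne'
  have hmarkov := mul_meas_ge_le_lintegral₀
    (Real.measurable_exp.comp_aemeasurable hf).ennreal_ofReal (ENNReal.ofReal (Real.exp B))
  rw [Real.exp_sub, ENNReal.ofReal_div_of_pos (Real.exp_pos B),
    ENNReal.le_div_iff_mul_le (Or.inl hB) (Or.inl ENNReal.ofReal_ne_top), mul_comm]
  refine le_trans (mul_le_mul_right (measure_mono fun x hx => ?_) _) (hmarkov.trans hA)
  exact ENNReal.ofReal_le_ofReal (Real.exp_le_exp.2 hx)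

theorem sq_setLIntegral_le {f : Ω → ENNReal} (hf : AEMeasurable f μ) (s : Set Ω) :
    (∫⁻ x in s, f x ∂μ) ^ 2 ≤ (∫⁻ x, f x ^ 2 ∂μ) * μ s := by
  have holder := ENNReal.lintegral_mul_le_Lp_mul_Lq (μ.restrict s) Real.HolderConjugate.two_two
    hf.restrict (aemeasurable_const (b := (1 : ENNReal)))
  simp only [Pi.mul_apply, mul_one, ENNReal.rpow_ofNat, one_pow, lintegral_one,
    Measure.restrict_apply_univ] at holder
  calc _ ≤ ((∫⁻ x in s, f x ^ 2 ∂μ) ^ (1 / 2 : ℝ) * μ s ^ (1 / 2 : ℝ)) ^ 2 := by gcongr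
    _ = (∫⁻ x in s, f x ^ 2 ∂μ) * μ s := by
        rw [mul_pow, ← ENNReal.rpow_natCast, ← ENNReal.rpow_natCast, ← ENNReal.rpow_mul,
          ← ENNReal.rpow_mul]
        norm_num
    _ ≤ _ := by
        gcongr
        exact Measure.restrict_le_self

/-- The Paley–Zygmund inequality. -/
theorem sq_lintegral_le_four_mul_lintegral_sq_mul_measure [IsProbabilityMeasure μ]
    {f : Ω → ENNReal} (hf : AEMeasurable f μ) (hfin : ∫⁻ x, f x ∂μ ≠ ⊤) {c : ENNReal}
    (hc : 2 * c ≤ ∫⁻ x, f x ∂μ) :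
    (∫⁻ x, f x ∂μ) ^ 2 ≤ 4 * ((∫⁻ x, f x ^ 2 ∂μ) * μ {x | c < f x}) := by
  set s := {x | c < f x}
  have hsplit : ∫⁻ x, f x ∂μ ≤ c + ∫⁻ x in s, f x ∂μ := by
    calc _ ≤ ∫⁻ x, (c + s.indicator f x) ∂μ := by
          refine lintegral_mono fun x => ?_
          by_cases hx : x ∈ s
          · simp only [Set.indicator_of_mem hx, le_add_self]
          · simpa only [Set.indicator_of_notMem hx, add_zero] using not_lt.1 hx
      _ ≤ _ := by
          rw [lintegral_add_left measurable_const, lintegral_const, measure_univ, mul_one]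
          exact add_le_add le_rfl (lintegral_indicator_le f s)
  have hhalf : ∫⁻ x, f x ∂μ ≤ 2 * ∫⁻ x in s, f x ∂μ := by
    refine (ENNReal.add_le_add_iff_left hfin).1 ?_
    calc _ = 2 * ∫⁻ x, f x ∂μ := (two_mul _).symm
      _ ≤ 2 * c + 2 * ∫⁻ x in s, f x ∂μ := by
          rw [← mul_add]
          gcongr
      _ ≤ _ := by gcongr
  calc _ ≤ (2 * ∫⁻ x in s, f x ∂μ) ^ 2 := by gcongr
    _ = 4 * (∫⁻ x in s, f x ∂μ) ^ 2 := by
        rw [mul_pow]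
        norm_num
    _ ≤ _ := by
        gcongr
        exact sq_setLIntegral_le hf s

theorem exp_le_four_mul_measure_lt_of_lintegral_exp [IsProbabilityMeasure μ] {f : Ω → ℝ}
    (hf : AEMeasurable f μ) {A B c : ℝ}
    (hfin : ∫⁻ x, ENNReal.ofReal (Real.exp (f x)) ∂μ ≠ ⊤)
    (hA : ENNReal.ofReal (Real.exp A) ≤ ∫⁻ x, ENNReal.ofReal (Real.exp (f x)) ∂μ)
    (hB : ∫⁻ x, ENNReal.ofReal (Real.exp (2 * f x)) ∂μ ≤ ENNReal.ofReal (Real.exp B))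
    (hc : 2 * Real.exp c ≤ Real.exp A) :
    ENNReal.ofReal (Real.exp (2 * A - B)) ≤ 4 * μ {x | c < f x} := by
  have hsq (x : Ω) : ENNReal.ofReal (Real.exp (f x)) ^ 2 =
      ENNReal.ofReal (Real.exp (2 * f x)) := by
    rw [← ENNReal.ofReal_pow (Real.exp_pos _).le, ← Real.exp_nat_mul, Nat.cast_ofNat]
  have hlevel : 2 * ENNReal.ofReal (Real.exp c) ≤
      ∫⁻ x, ENNReal.ofReal (Real.exp (f x)) ∂μ := by
    rw [← ENNReal.ofReal_ofNat 2, ← ENNReal.ofReal_mul zero_le_two]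
    exact (ENNReal.ofReal_le_ofReal hc).trans hA
  have hpz := sq_lintegral_le_four_mul_lintegral_sq_mul_measure
    (Real.measurable_exp.comp_aemeasurable hf).ennreal_ofReal hfin hlevel
  simp only [Function.comp_apply, hsq,
    ENNReal.ofReal_lt_ofReal_iff (Real.exp_pos _), Real.exp_lt_exp] at hpz
  rw [Real.exp_sub, ENNReal.ofReal_div_of_pos (Real.exp_pos B)]
  refine ENNReal.div_le_of_le_mul ?_
  calc _ = ENNReal.ofReal (Real.exp A) ^ 2 := by
        rw [← ENNReal.ofReal_pow (Real.exp_pos _).le, ← Real.exp_nat_mul, Nat.cast_ofNat]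
    _ ≤ _ := pow_le_pow_left' hA 2
    _ ≤ _ := hpz
    _ ≤ 4 * (ENNReal.ofReal (Real.exp B) * μ {x | c < f x}) := by gcongr
    _ = _ := by rw [mul_right_comm, mul_assoc]

theorem exp_le_measure_two_mul_sq_lt_of_lintegral_exp [IsProbabilityMeasure μ] {f : Ω → ℝ}
    (hf : AEMeasurable f μ) {t : ℝ} (ht : 1 ≤ t)
    (hfin : ∫⁻ x, ENNReal.ofReal (Real.exp (f x)) ∂μ ≠ ⊤)
    (hmean : ENNReal.ofReal (Real.exp ((2 * t) ^ 2)) ≤ ∫⁻ x, ENNReal.ofReal (Real.exp (f x)) ∂μ)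
    (hsecond : ∫⁻ x, ENNReal.ofReal (Real.exp (2 * f x)) ∂μ ≤
      ENNReal.ofReal (Real.exp (4 * (2 * (2 * t)) ^ 2))) :
    ENNReal.ofReal (Real.exp (-(58 * t ^ 2))) ≤ μ {x | 2 * t ^ 2 < f x} := by
  have hexp_four : 4 ≤ Real.exp (2 * t ^ 2) := by
    nlinarith [Real.quadratic_le_exp_of_nonneg (by positivity : 0 ≤ 2 * t ^ 2)]
  have hlevel : 2 * Real.exp (2 * t ^ 2) ≤ Real.exp ((2 * t) ^ 2) := by
    rw [show (2 * t) ^ 2 = 2 * t ^ 2 + 2 * t ^ 2 by ring, Real.exp_add]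
    nlinarith
  have hquarter : Real.exp (-(58 * t ^ 2)) ≤
      Real.exp (2 * (2 * t) ^ 2 - 4 * (2 * (2 * t)) ^ 2) / 4 := by
    rw [le_div_iff₀ four_pos, show 2 * (2 * t) ^ 2 - 4 * (2 * (2 * t)) ^ 2 =
      -(58 * t ^ 2) + 2 * t ^ 2 by ring, Real.exp_add]
    gcongr
  refine (ENNReal.ofReal_le_ofReal hquarter).trans ?_
  rw [ENNReal.ofReal_div_of_pos four_pos, ENNReal.ofReal_ofNat]
  exact ENNReal.div_le_of_le_mul'
    (exp_le_four_mul_measure_lt_of_lintegral_exp hf hfin hmean hsecond hlevel)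

/-- Weights `ϰ²_{εj}` at a single noise level as in condition A1, numbered from `0` and not
all zero. -/
structure IsWeightSeq (a : ℕ → ℝ) : Prop where
  antitone : Antitone a
  summable : Summable a
  pos : 0 < a 0

/-- The Euclidean norm `(∑ a_j²)^{1/2}` of a sequence of weights: up to a factor `√2`, the standard
deviation of `∑ a_j ξ_j²` for independent standard normal `ξ_j`. -/
def weightNorm (a : ℕ → ℝ) : ℝ := √(∑' j, a j ^ 2)

/-- The drift `∑ a_j h_j²` of the mean of `∑ a_j (ξ_j + h_j)²` due to the shifts `h_j`. -/
def drift (a h : ℕ → ℝ) : ℝ := ∑' j, a j * h j ^ 2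

theorem sq_weightNorm (a : ℕ → ℝ) : weightNorm a ^ 2 = ∑' j, a j ^ 2 :=
  Real.sq_sqrt (tsum_nonneg fun _ => sq_nonneg _)

variable {ξ : ℕ → Ω → ℝ} {a h : ℕ → ℝ}

theorem drift_nonneg (ha : ∀ j, 0 ≤ a j) (h : ℕ → ℝ) : 0 ≤ drift a h :=
  tsum_nonneg fun j => mul_nonneg (ha j) (sq_nonneg _)

namespace IsWeightSeq

theorem nonneg (ha : IsWeightSeq a) (j : ℕ) : 0 ≤ a j :=
  ha.antitone.le_of_tendsto ha.summable.tendsto_atTop_zero j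

theorem le_zero (ha : IsWeightSeq a) (j : ℕ) : a j ≤ a 0 := ha.antitone (Nat.zero_le j)

theorem summable_mul (ha : IsWeightSeq a) {g : ℕ → ℝ} (hg : ∀ j, 0 ≤ g j) (hs : Summable g) :
    Summable fun j => a j * g j :=
  .of_nonneg_of_le (fun j => mul_nonneg (ha.nonneg j) (hg j))
    (fun j => mul_le_mul_of_nonneg_right (ha.le_zero j) (hg j)) (hs.mul_left (a 0))

theorem summable_sq (ha : IsWeightSeq a) : Summable fun j => a j ^ 2 := by
  simpa only [sq] using ha.summable_mul ha.nonneg ha.summable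

theorem weightNorm_pos (ha : IsWeightSeq a) : 0 < weightNorm a :=
  Real.sqrt_pos.2 (ha.summable_sq.tsum_pos (fun _ => sq_nonneg _) 0 (pow_pos ha.pos 2))

theorem summable_mul_one_add_sq (ha : IsWeightSeq a) (hh : Summable fun j => h j ^ 2) :
    Summable fun j => a j * (1 + h j ^ 2) := by
  simpa only [mul_add, mul_one] using
    ha.summable.add (ha.summable_mul (fun _ => sq_nonneg _) hh)

theorem varianceProxy_le (ha : IsWeightSeq a) (hh : Summable fun j => h j ^ 2) :
    varianceProxy a h ≤ weightNorm a ^ 2 + a 0 * drift a h := by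
  have hah := ha.summable_mul (fun _ => sq_nonneg _) hh
  rw [sq_weightNorm, drift, ← tsum_mul_left, ← ha.summable_sq.tsum_add (hah.mul_left _)]
  refine (summable_sq_mul ha.nonneg (ha.summable_mul_one_add_sq hh)).tsum_le_tsum (fun j => ?_)
    (ha.summable_sq.add (hah.mul_left _))
  nlinarith [mul_le_mul_of_nonneg_right (ha.le_zero j)
    (mul_nonneg (ha.nonneg j) (sq_nonneg (h j)))]

end IsWeightSeq

theorem varianceProxy_zero (a : ℕ → ℝ) : varianceProxy a 0 = weightNorm a ^ 2 := by
  simp only [varianceProxy, sq_weightNorm, Pi.zero_apply, ne_eq, OfNat.ofNat_ne_zero,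
    not_false_eq_true, zero_pow, add_zero, mul_one]

namespace IsStdNormalSeq

theorem measure_lt_centeredChiSq_le_exp (hξ : IsStdNormalSeq ξ μ) (ha : IsWeightSeq a)
    (hh : Summable fun j => h j ^ 2) {u : ℝ} (hu₀ : 0 ≤ u) (hu : u * a 0 ≤ 1 / 4) (y : ℝ) :
    μ {x | y < centeredChiSq a h (ξ · x)} ≤
      ENNReal.ofReal (Real.exp (4 * u ^ 2 * varianceProxy a h - u * y)) := by
  have hlaplace := hξ.lintegral_exp_mul_centeredChiSq_le ha.nonneg
    (ha.summable_mul_one_add_sq hh) (u := u)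
    fun j => (mul_le_mul_of_nonneg_left (ha.le_zero j) hu₀).trans hu
  refine (measure_mono fun x hx => ?_).trans (measure_ge_le_exp_sub_of_lintegral_exp_le
    ((hξ.aemeasurable_centeredChiSq a h).const_mul u) hlaplace (u * y))
  exact mul_le_mul_of_nonneg_left (le_of_lt hx) hu₀

theorem measure_centeredChiSq_le_le_exp (hξ : IsStdNormalSeq ξ μ) (ha : IsWeightSeq a)
    (hh : Summable fun j => h j ^ 2) {u : ℝ} (hu₀ : 0 ≤ u) (y : ℝ) :
    μ {x | centeredChiSq a h (ξ · x) ≤ -y} ≤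
      ENNReal.ofReal (Real.exp (4 * u ^ 2 * varianceProxy a h - u * y)) := by
  have hlaplace := hξ.lintegral_exp_mul_centeredChiSq_le ha.nonneg
    (ha.summable_mul_one_add_sq hh) (u := -u)
    fun j => by linarith [mul_nonneg hu₀ (ha.nonneg j)]
  rw [neg_sq] at hlaplace
  refine (measure_mono fun x hx => ?_).trans (measure_ge_le_exp_sub_of_lintegral_exp_le
    ((hξ.aemeasurable_centeredChiSq a h).const_mul (-u)) hlaplace (u * y))
  have hx : centeredChiSq a h (ξ · x) ≤ -y := hx
  change u * y ≤ -u * centeredChiSq a h (ξ · x)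
  nlinarith

theorem measure_lt_centeredChiSq_zero_le (hξ : IsStdNormalSeq ξ μ) (ha : IsWeightSeq a) {y : ℝ}
    (hy : 0 ≤ y) (hya : y * a 0 ≤ weightNorm a) :
    μ {x | y * weightNorm a < centeredChiSq a 0 (ξ · x)} ≤
      ENNReal.ofReal (Real.exp (-(y ^ 2 / 16))) := by
  have hσ := ha.weightNorm_pos
  have hu : y / 8 / weightNorm a * a 0 ≤ 1 / 4 := by
    rw [div_mul_eq_mul_div, div_le_iff₀ hσ]
    linarith
  refine (hξ.measure_lt_centeredChiSq_le_exp ha (by simp) (by positivity) hu _).trans_eq ?_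
  rw [varianceProxy_zero]
  congr 2
  field_simp
  ring

theorem measure_centeredChiSq_add_drift_le_le (hξ : IsStdNormalSeq ξ μ) (ha : IsWeightSeq a)
    (hh : Summable fun j => h j ^ 2) {y : ℝ} (hy : 0 ≤ y) (hya : y * a 0 ≤ weightNorm a)
    (hyD : y * weightNorm a ≤ drift a h) :
    μ {x | centeredChiSq a h (ξ · x) + drift a h ≤ y / 4 * weightNorm a} ≤
      ENNReal.ofReal (Real.exp (-(y ^ 2 / 64))) := by
  have hσ := ha.weightNorm_pos
  have hv := ha.varianceProxy_le hh
  set σ := weightNorm a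
  set D := drift a h
  have hexponent :
      4 * (y / 16 / σ) ^ 2 * varianceProxy a h - y / 16 / σ * (3 / 4 * D) ≤ -(y ^ 2 / 64) := by
    have hproxy : y * varianceProxy a h ≤ 2 * (σ * D) := by
      have := mul_le_mul_of_nonneg_left hv hy
      nlinarith [mul_le_mul_of_nonneg_right hya (drift_nonneg ha.nonneg h)]
    have hleft : 4 * (y / 16 / σ) ^ 2 * varianceProxy a h - y / 16 / σ * (3 / 4 * D) =
        y / (64 * σ ^ 2) * (y * varianceProxy a h - 3 * (σ * D)) := by
      field_simp
      ring
    have hright : y ^ 2 / 64 = y / (64 * σ ^ 2) * (σ * (y * σ)) := by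
      field_simp
    rw [hleft, hright, ← mul_neg]
    refine mul_le_mul_of_nonneg_left ?_ (by positivity)
    linarith [mul_le_mul_of_nonneg_left hyD hσ.le]
  refine (measure_mono fun x hx => ?_).trans ((hξ.measure_centeredChiSq_le_le_exp ha hh
    (by positivity : 0 ≤ y / 16 / σ) (3 / 4 * D)).trans
      (ENNReal.ofReal_le_ofReal (Real.exp_le_exp.2 hexponent)))
  have hx : centeredChiSq a h (ξ · x) + D ≤ y / 4 * σ := hx
  change centeredChiSq a h (ξ · x) ≤ -(3 / 4 * D)
  linarith

theorem exp_neg_one_le_measure_centeredChiSq_add_drift_le (hξ : IsStdNormalSeq ξ μ)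
    (ha : IsWeightSeq a) (hh : Summable fun j => h j ^ 2) (haσ : 4 * a 0 ≤ weightNorm a) :
    ENNReal.ofReal (Real.exp (-1)) ≤ μ {x | centeredChiSq a h (ξ · x) + drift a h ≤
      (2 * (drift a h / weightNorm a) + 5) * weightNorm a} := by
  have := hξ.isProbabilityMeasure
  have hσ := ha.weightNorm_pos
  have hv := ha.varianceProxy_le hh
  have hD := drift_nonneg ha.nonneg h
  set σ := weightNorm a
  set D := drift a h
  have hexponent : 4 * (1 / σ) ^ 2 * varianceProxy a h - 1 / σ * (D + 5 * σ) ≤ -1 := by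
    have hleft : 4 * (1 / σ) ^ 2 * varianceProxy a h - 1 / σ * (D + 5 * σ) =
        (4 * varianceProxy a h - σ * D) / σ ^ 2 - 5 := by
      field_simp
      ring
    rw [hleft, sub_le_iff_le_add, div_le_iff₀ (by positivity)]
    nlinarith [mul_le_mul_of_nonneg_right haσ hD]
  have hupper : μ {x | D + 5 * σ < centeredChiSq a h (ξ · x)} ≤
      ENNReal.ofReal (Real.exp (-1)) := by
    refine (hξ.measure_lt_centeredChiSq_le_exp ha hh (by positivity : 0 ≤ 1 / σ) ?_ _).trans
      (ENNReal.ofReal_le_ofReal (Real.exp_le_exp.2 hexponent))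
    rw [one_div_mul_eq_div, div_le_iff₀ hσ]
    linarith
  have hcover : 1 ≤ μ {x | centeredChiSq a h (ξ · x) + D ≤ (2 * (D / σ) + 5) * σ} +
      μ {x | D + 5 * σ < centeredChiSq a h (ξ · x)} := by
    rw [← measure_univ (μ := μ)]
    refine (measure_mono fun x _ => ?_).trans (measure_union_le _ _)
    refine (le_or_gt (centeredChiSq a h (ξ · x)) (D + 5 * σ)).imp (fun hx => ?_) id
    change centeredChiSq a h (ξ · x) + D ≤ (2 * (D / σ) + 5) * σ
    rw [add_mul, mul_assoc, div_mul_cancel₀ _ hσ.ne']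
    linarith
  have hhalf : ENNReal.ofReal (Real.exp (-1)) + ENNReal.ofReal (Real.exp (-1)) ≤ 1 := by
    rw [← ENNReal.ofReal_add (Real.exp_pos _).le (Real.exp_pos _).le, ENNReal.ofReal_le_one]
    linarith [Real.exp_neg_one_lt_half]
  exact (ENNReal.add_le_add_iff_right ENNReal.ofReal_ne_top).1
    (hhalf.trans (hcover.trans (add_le_add le_rfl hupper)))

theorem lintegral_exp_mul_centeredChiSq_zero_le (hξ : IsStdNormalSeq ξ μ) (ha : IsWeightSeq a)
    {u : ℝ} (hu₀ : 0 ≤ u) (hu : u * a 0 ≤ 1 / 4) :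
    ∫⁻ x, ENNReal.ofReal (Real.exp (u * centeredChiSq a 0 (ξ · x))) ∂μ ≤
      ENNReal.ofReal (Real.exp (4 * (u * weightNorm a) ^ 2)) := by
  rw [mul_pow, ← varianceProxy_zero, ← mul_assoc]
  exact hξ.lintegral_exp_mul_centeredChiSq_le ha.nonneg (by simpa using ha.summable)
    fun j => (mul_le_mul_of_nonneg_left (ha.le_zero j) hu₀).trans hu

theorem le_lintegral_exp_mul_centeredChiSq_zero (hξ : IsStdNormalSeq ξ μ) (ha : IsWeightSeq a)
    {u : ℝ} (hu₀ : 0 ≤ u) (hu : u * a 0 < 1 / 2) :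
    ENNReal.ofReal (Real.exp ((u * weightNorm a) ^ 2)) ≤
      ∫⁻ x, ENNReal.ofReal (Real.exp (u * centeredChiSq a 0 (ξ · x))) ∂μ := by
  rw [mul_pow, ← varianceProxy_zero]
  exact hξ.le_lintegral_exp_mul_centeredChiSq ha.nonneg (by simpa using ha.summable) hu₀
    fun j => (mul_le_mul_of_nonneg_left (ha.le_zero j) hu₀).trans_lt hu

/-- The second moment method applied to `exp (u X)`, where `u = 2 t / σ` puts the mean well above
the value at the level `t σ`. -/
theorem exp_le_measure_lt_centeredChiSq_zero (hξ : IsStdNormalSeq ξ μ) (ha : IsWeightSeq a) {t : ℝ}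
    (ht : 1 ≤ t) (hta : 16 * t * a 0 ≤ weightNorm a) :
    ENNReal.ofReal (Real.exp (-(58 * t ^ 2))) ≤
      μ {x | t * weightNorm a < centeredChiSq a 0 (ξ · x)} := by
  have := hξ.isProbabilityMeasure
  have hσ := ha.weightNorm_pos
  set u := 2 * t / weightNorm a with hu_def
  have hu₀ : 0 ≤ u := by positivity
  have huσ : u * weightNorm a = 2 * t := div_mul_cancel₀ _ hσ.ne'
  have hua : u * a 0 ≤ 1 / 8 := by
    rw [hu_def, div_mul_eq_mul_div, div_le_iff₀ hσ]
    linarith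
  have hmean_le := hξ.lintegral_exp_mul_centeredChiSq_zero_le ha hu₀ (hua.trans (by norm_num))
  have hmean := hξ.le_lintegral_exp_mul_centeredChiSq_zero ha hu₀ (hua.trans_lt (by norm_num))
  have hsecond := hξ.lintegral_exp_mul_centeredChiSq_zero_le ha (u := 2 * u) (by positivity)
    (by linarith)
  rw [mul_assoc 2, huσ] at hsecond
  rw [huσ] at hmean
  have hevent (x : Ω) : 2 * t ^ 2 < u * centeredChiSq a 0 (ξ · x) ↔
      t * weightNorm a < centeredChiSq a 0 (ξ · x) := by
    rw [hu_def, div_mul_eq_mul_div, lt_div_iff₀ hσ,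
      show 2 * t ^ 2 * weightNorm a = 2 * t * (t * weightNorm a) by ring,
      mul_lt_mul_iff_right₀ (by positivity)]
  simpa only [hevent] using exp_le_measure_two_mul_sq_lt_of_lintegral_exp
    ((hξ.aemeasurable_centeredChiSq a 0).const_mul u) ht
    (hmean_le.trans_lt ENNReal.ofReal_lt_top).ne hmean (by simpa only [mul_assoc] using hsecond)

end IsStdNormalSeq

end Tails

section Geometry

variable {H : Type*} [NormedAddCommGroup H] [InnerProductSpace ℝ H] (b : HilbertBasis ℕ ℝ H)

/-- The span of the first `i` vectors of an orthonormal basis; in `L₂(0,1)` it is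
`greedySpan b i`. -/
def headSpan (i : ℕ) : Submodule ℝ H :=
  Submodule.span ℝ (Set.range fun k : Fin i => b k)

instance (i : ℕ) : FiniteDimensional ℝ (headSpan b i) :=
  FiniteDimensional.span_of_finite ℝ (Set.finite_range _)

/-- The residual `x - ∑_{j < i} ⟪b j, x⟫ b j` of the orthogonal expansion of `x`, as a continuous
linear map of `x`. -/
def tail (i : ℕ) : H →L[ℝ] H :=
  ContinuousLinearMap.id ℝ H - (headSpan b i).starProjection

theorem tail_apply (i : ℕ) (x : H) : tail b i x = x - (headSpan b i).starProjection x := rfl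

theorem hasSum_inner_sq (x : H) : HasSum (fun j => (inner ℝ (b j) x : ℝ) ^ 2) (‖x‖ ^ 2) := by
  rw [← real_inner_self_eq_norm_sq]
  refine (b.hasSum_inner_mul_inner x x).congr_fun fun j => ?_
  rw [real_inner_comm, sq]

theorem mem_headSpan {i j : ℕ} (hj : j < i) : b j ∈ headSpan b i :=
  Submodule.subset_span ⟨⟨j, hj⟩, rfl⟩

theorem inner_tail (i j : ℕ) (x : H) :
    inner ℝ (b j) (tail b i x) = if i ≤ j then (inner ℝ (b j) x : ℝ) else 0 := by
  rw [tail_apply]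
  split_ifs with hij
  · have head_le : headSpan b i ≤ (ℝ ∙ b j)ᗮ := by
      refine Submodule.span_le.2 ?_
      rintro _ ⟨k, rfl⟩
      exact Submodule.mem_orthogonal_singleton_iff_inner_right.2
        (b.orthonormal.2 (by lia : j ≠ (k : ℕ)))
    have orthogonal := Submodule.mem_orthogonal_singleton_iff_inner_right.1
      (head_le ((headSpan b i).starProjection_apply_mem x))
    rw [inner_sub_right, orthogonal, sub_zero]
  · rw [real_inner_comm]
    exact Submodule.starProjection_inner_eq_zero x (b j) (mem_headSpan b (not_le.1 hij))

theorem hasSum_tail (i : ℕ) (x : H) :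
    HasSum (fun j => if i ≤ j then (inner ℝ (b j) x : ℝ) ^ 2 else 0) (‖tail b i x‖ ^ 2) := by
  refine (hasSum_inner_sq b _).congr_fun fun j => ?_
  rw [inner_tail]
  split_ifs <;> simp

theorem hasSum_head (i : ℕ) (x : H) :
    HasSum (fun j => if i ≤ j then 0 else (inner ℝ (b j) x : ℝ) ^ 2)
      (‖x‖ ^ 2 - ‖tail b i x‖ ^ 2) := by
  refine ((hasSum_inner_sq b x).sub (hasSum_tail b i x)).congr_fun fun j => ?_
  split_ifs <;> simp

theorem tail_zero (x : H) : tail b 0 x = x := by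
  simp [tail_apply, headSpan]

theorem tail_basis (i k : ℕ) : tail b i (b k) = if i ≤ k then b k else 0 := by
  refine b.repr.injective (lp.ext (funext fun j => ?_))
  rw [b.repr_apply_apply, b.repr_apply_apply, inner_tail]
  rcases eq_or_ne j k with rfl | hjk
  · split_ifs <;> simp
  · split_ifs <;> simp [b.orthonormal.2 hjk]

theorem headSpan_mono : Monotone (headSpan b) := fun i j hij =>
  Submodule.span_mono (by rintro _ ⟨k, rfl⟩; exact ⟨⟨k, k.2.trans_le hij⟩, rfl⟩)

theorem tendsto_tail (x : H) : Tendsto (fun i => tail b i x) atTop (𝓝 0) := by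
  have dense : (⊤ : Submodule ℝ H) ≤ (⨆ i, headSpan b i).topologicalClosure := by
    rw [← b.dense_span]
    refine Submodule.topologicalClosure_mono (Submodule.span_le.2 ?_)
    rintro _ ⟨j, rfl⟩
    exact Submodule.mem_iSup_of_mem (j + 1) (mem_headSpan b j.lt_succ_self)
  simpa only [tail_apply, sub_self] using
    (Submodule.starProjection_tendsto_self _ (headSpan_mono b) x dense).const_sub x

/-- The vectors whose distance to the span of the first `i` basis vectors is at most `c i`, for
every `i`. The balls `B̄^s_{2∞}` are of this form, see `besovBall_eq_tailBall`. -/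
def tailBall (c : ℕ → ℝ) : Set H := {x | ∀ i, ‖tail b i x‖ ≤ c i}

variable {b} {a c : ℕ → ℝ}

theorem tailBall_mono (hac : ∀ i, a i ≤ c i) : tailBall b a ⊆ tailBall b c :=
  fun _ hx i => (hx i).trans (hac i)

theorem tailBall_eq_iInter : tailBall b c = ⋂ i, tail b i ⁻¹' Metric.closedBall 0 (c i) := by
  ext x
  simp [tailBall]

theorem convex_tailBall : Convex ℝ (tailBall b c) := by
  rw [tailBall_eq_iInter]
  exact convex_iInter fun i => (convex_closedBall _ _).linear_preimage (tail b i).toLinearMap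

theorem isClosed_tailBall : IsClosed (tailBall b c) := by
  rw [tailBall_eq_iInter]
  exact isClosed_iInter fun i => Metric.isClosed_closedBall.preimage (tail b i).continuous

theorem add_mem_tailBall {x y : H} (hx : x ∈ tailBall b a) (hy : y ∈ tailBall b c) :
    x + y ∈ tailBall b (a + c) := fun i => by
  rw [map_add]
  exact (norm_add_le _ _).trans (add_le_add (hx i) (hy i))

theorem smul_mem_tailBall (K : ℝ) {x : H} (hx : x ∈ tailBall b c) :
    K • x ∈ tailBall b (|K| • c) := fun i => by
  rw [map_smul, norm_smul]
  exact mul_le_mul_of_nonneg_left (hx i) (norm_nonneg K)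

theorem neg_mem_tailBall {x : H} (hx : x ∈ tailBall b c) : -x ∈ tailBall b c := by
  simpa using smul_mem_tailBall (-1) hx

theorem totallyBounded_tailBall (hc : Tendsto c atTop (𝓝 0)) : TotallyBounded (tailBall b c) := by
  refine Metric.totallyBounded_iff.2 fun δ hδ => ?_
  obtain ⟨i, hi⟩ := (hc.eventually (gt_mem_nhds (half_pos hδ))).exists
  have compact_head : IsCompact ((headSpan b i).subtypeL '' Metric.closedBall 0 (c 0)) :=
    (isCompact_closedBall _ _).image (headSpan b i).subtypeL.continuous
  obtain ⟨t, ht, cover⟩ := Metric.totallyBounded_iff.1 compact_head.totallyBounded _ (half_pos hδ)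
  refine ⟨t, ht, fun x hx => ?_⟩
  have norm_le : ‖x‖ ≤ c 0 := tail_zero b x ▸ hx 0
  have mem_head : (headSpan b i).starProjection x ∈
      (headSpan b i).subtypeL '' Metric.closedBall 0 (c 0) := by
    refine ⟨⟨_, (headSpan b i).starProjection_apply_mem x⟩, ?_, rfl⟩
    exact mem_closedBall_zero_iff.2 (((headSpan b i).norm_starProjection_apply_le x).trans norm_le)
  obtain ⟨y, hy, hxy⟩ := Set.mem_iUnion₂.1 (cover mem_head)
  refine Set.mem_iUnion₂.2 ⟨y, hy, Metric.mem_ball.2 ?_⟩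
  have dist_head : dist x ((headSpan b i).starProjection x) < δ / 2 := by
    rw [dist_eq_norm]
    exact (hx i).trans_lt hi
  linarith [dist_triangle x ((headSpan b i).starProjection x) y, Metric.mem_ball.1 hxy]

theorem isCompact_tailBall [CompleteSpace H] (hc : Tendsto c atTop (𝓝 0)) :
    IsCompact (tailBall b c) :=
  isCompact_iff_totallyBounded_isComplete.2
    ⟨totallyBounded_tailBall hc, isClosed_tailBall.isComplete⟩

theorem span_tailBall (hc : ∀ i, 0 ≤ c i) :
    (Submodule.span ℝ (tailBall b c) : Set H) = {x | ∃ K : ℝ, x ∈ tailBall b (K • c)} := by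
  refine Set.Subset.antisymm (fun x hx => ?_) ?_
  · rw [SetLike.mem_coe] at hx
    induction hx using Submodule.span_induction with
    | mem x hx => exact ⟨1, by rwa [one_smul]⟩
    | zero => exact ⟨0, fun i => by simp⟩
    | add x y _ _ hx hy =>
      obtain ⟨K, hx⟩ := hx
      obtain ⟨L, hy⟩ := hy
      exact ⟨K + L, add_smul K L c ▸ add_mem_tailBall hx hy⟩
    | smul k x _ hx =>
      obtain ⟨K, hx⟩ := hx
      exact ⟨|k| * K, mul_smul |k| K c ▸ smul_mem_tailBall k hx⟩
  · rintro x ⟨K, hx⟩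
    have hL : 0 < max K 1 := lt_max_of_lt_right one_pos
    have mem : (max K 1)⁻¹ • x ∈ tailBall b c := by
      have le_max : ∀ i, (K • c) i ≤ (max K 1 • c) i := fun i =>
        mul_le_mul_of_nonneg_right (le_max_left K 1) (hc i)
      have := smul_mem_tailBall (max K 1)⁻¹ (tailBall_mono le_max hx)
      rwa [abs_of_pos (inv_pos.2 hL), inv_smul_smul₀ hL.ne'] at this
    simpa only [smul_inv_smul₀ hL.ne', SetLike.mem_coe] using
      Submodule.smul_mem _ (max K 1) (Submodule.subset_span (R := ℝ) mem)

theorem smul_basis_mem_tailBall (hanti : Antitone c) (hc : ∀ i, 0 ≤ c i) (k : ℕ) :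
    c k • b k ∈ tailBall b c := fun i => by
  rw [map_smul, tail_basis]
  split_ifs with hik
  · rw [norm_smul, b.orthonormal.1 k, mul_one, Real.norm_of_nonneg (hc k)]
    exact hanti hik
  · simpa using hc i

/-- If `‖x i‖` is at least of order `k i ^ (-s)`, a fixed multiple of `k i` coordinates carries
three quarters of the squared norm of `x i`. -/
theorem exists_norm_tail_le_half {ι : Type*} {l : Filter ι} {x : ι → H} {k : ι → ℝ} {s C : ℝ}
    (hs : 0 < s) (hx : ∀ᶠ i in l, x i ∈ tailBall b fun j => C * ((j : ℝ) + 1) ^ (-s))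
    (hk : ∀ᶠ i in l, 0 < k i) (hkx : (fun i => k i ^ (-s)) =O[l] fun i => ‖x i‖) :
    ∃ c > 1, ∀ᶠ i in l, ‖tail b ⌊c * k i⌋₊ (x i)‖ ≤ ‖x i‖ / 2 := by
  obtain ⟨K, bound⟩ := hkx.bound
  have small : Tendsto (fun c : ℝ => |C| * c ^ (-s) * K) atTop (𝓝 0) := by
    simpa using ((tendsto_rpow_neg_atTop hs).const_mul |C|).mul_const K
  obtain ⟨c, hc, hc1⟩ :=
    ((small.eventually (gt_mem_nhds one_half_pos)).and (eventually_gt_atTop 1)).exists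
  refine ⟨c, hc1, ?_⟩
  have hc0 : 0 < c := one_pos.trans hc1
  filter_upwards [hx, hk, bound] with i hxi hki hbi
  have hck : 0 < c * k i := mul_pos hc0 hki
  rw [norm_norm, Real.norm_of_nonneg (Real.rpow_nonneg hki.le _)] at hbi
  calc ‖tail b ⌊c * k i⌋₊ (x i)‖ ≤ C * ((⌊c * k i⌋₊ : ℝ) + 1) ^ (-s) := hxi _
    _ ≤ |C| * (c * k i) ^ (-s) := mul_le_mul (le_abs_self C)
        (Real.rpow_le_rpow_of_nonpos hck (Nat.lt_floor_add_one _).le (neg_nonpos.2 hs.le))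
        (by positivity) (abs_nonneg C)
    _ = |C| * c ^ (-s) * k i ^ (-s) := by rw [Real.mul_rpow hc0.le hki.le, mul_assoc]
    _ ≤ |C| * c ^ (-s) * (K * ‖x i‖) := by gcongr
    _ = |C| * c ^ (-s) * K * ‖x i‖ := by ring
    _ ≤ 1 / 2 * ‖x i‖ := by gcongr
    _ = ‖x i‖ / 2 := by ring

end Geometry

section Besov

variable {b : HilbertBasis ℕ ℝ L2} {c : ℕ → ℝ} {s P : ℝ}

theorem greedyResidual_smul_basis (hc : ∀ i, c i ≠ 0) (S : L2) (i : ℕ) :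
    greedyResidual (fun k => c k • b k) S i = tail b i S := by
  have span_eq : greedySpan (fun k => c k • b k) i = headSpan b i := by
    refine le_antisymm (Submodule.span_le.2 ?_) (Submodule.span_le.2 ?_)
    · rintro _ ⟨k, rfl⟩
      exact Submodule.smul_mem _ _ (mem_headSpan b k.2)
    · rintro _ ⟨k, rfl⟩
      have : c k • b k ∈ greedySpan (fun k => c k • b k) i := Submodule.subset_span ⟨k, rfl⟩
      simpa only [inv_smul_smul₀ (hc k), SetLike.mem_coe] using Submodule.smul_mem _ (c k)⁻¹ this
  rw [greedyResidual, tail_apply]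
  congr 3

theorem infDist_greedySpan (e : ℕ → L2) (S : L2) (i : ℕ) :
    Metric.infDist S (greedySpan e i : Set L2) = ‖greedyResidual e S i‖ := by
  rw [greedyResidual, Submodule.starProjection_minimal, Metric.infDist_eq_iInf]
  simp only [dist_eq_norm]
  rfl

theorem isGreedySystem_tailBall (hanti : Antitone c) (hc : ∀ i, 0 < c i) :
    IsGreedySystem (tailBall b c) fun i => c i • b i := fun i => by
  refine ⟨smul_basis_mem_tailBall hanti (fun i => (hc i).le) i, fun S hS => ?_⟩
  simp only [infDist_greedySpan, greedyResidual_smul_basis fun i => (hc i).ne']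
  rw [map_smul, tail_basis, if_pos le_rfl, norm_smul, b.orthonormal.1 i, mul_one,
    Real.norm_of_nonneg (hc i).le]
  exact hS i

theorem tsum_inner_sq_eq (S : L2) {lam : ℝ} (hlam : 0 ≤ lam) :
    ∑' j : ℕ, (if lam < (j : ℝ) + 1 then (inner ℝ (b j) S : ℝ) ^ 2 else 0) =
      ‖tail b ⌊lam⌋₊ S‖ ^ 2 := by
  rw [← (hasSum_tail b ⌊lam⌋₊ S).tsum_eq]
  have floor_le : ∀ j : ℕ, lam < (j : ℝ) + 1 ↔ ⌊lam⌋₊ ≤ j := fun j => by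
    rw [← Nat.lt_add_one_iff, Nat.floor_lt hlam, Nat.cast_add_one]
  simp only [floor_le]

theorem mem_besovBall_iff (hs : 0 ≤ s) {S : L2} :
    S ∈ besovBall b s P ↔ ∀ i : ℕ, ((i : ℝ) + 1) ^ (2 * s) * ‖tail b i S‖ ^ 2 ≤ P := by
  refine ⟨fun h i => ?_, fun h lam hlam => ?_⟩
  · -- For `λ ∈ (i, i + 1)` the tail is `tail b i S`; let `λ` increase to `i + 1`.
    have limit : Tendsto (fun lam : ℝ => lam ^ (2 * s) * ‖tail b i S‖ ^ 2) (𝓝[<] ((i : ℝ) + 1))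
        (𝓝 (((i : ℝ) + 1) ^ (2 * s) * ‖tail b i S‖ ^ 2)) :=
      ((Real.continuousAt_rpow_const _ _ (Or.inr (by positivity))).mul
        continuousAt_const).tendsto.mono_left nhdsWithin_le_nhds
    refine le_of_tendsto limit ?_
    filter_upwards [Ioo_mem_nhdsLT (lt_add_one (i : ℝ))] with lam hl
    have hlam : 0 < lam := (Nat.cast_nonneg i).trans_lt hl.1
    simpa only [tsum_inner_sq_eq S hlam.le, (Nat.floor_eq_iff hlam.le).2 ⟨hl.1.le, hl.2⟩]
      using h lam hlam
  · rw [tsum_inner_sq_eq S hlam.le]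
    refine le_trans (mul_le_mul_of_nonneg_right ?_ (sq_nonneg _)) (h ⌊lam⌋₊)
    exact Real.rpow_le_rpow hlam.le (Nat.lt_floor_add_one lam).le (by positivity)

theorem besovBall_eq_tailBall (hs : 0 ≤ s) (hP : 0 ≤ P) :
    besovBall b s P = tailBall b fun i => √P * ((i : ℝ) + 1) ^ (-s) := by
  ext S
  rw [mem_besovBall_iff hs]
  refine forall_congr' fun i => ?_
  beta_reduce
  have hi : (0 : ℝ) < (i : ℝ) + 1 := by positivity
  rw [Real.rpow_neg hi.le, ← div_eq_mul_inv, le_div_iff₀ (Real.rpow_pos_of_pos hi s),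
    Real.le_sqrt (by positivity) hP, mul_pow, two_mul, Real.rpow_add hi, ← sq, mul_comm]

theorem mem_besovSpace_iff (hs : 0 ≤ s) {S : L2} :
    S ∈ besovSpace b s ↔ ∃ K : ℝ, S ∈ tailBall b fun i => K * ((i : ℝ) + 1) ^ (-s) := by
  refine ⟨fun ⟨P, hP⟩ => ⟨√P, ?_⟩, fun ⟨K, hK⟩ => ⟨K ^ 2, ?_⟩⟩
  · have hP0 : 0 ≤ P := le_trans (by positivity) ((mem_besovBall_iff hs).1 hP 0)
    rwa [← besovBall_eq_tailBall hs hP0]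
  · rw [besovBall_eq_tailBall hs (sq_nonneg K), Real.sqrt_sq_eq_abs]
    exact tailBall_mono (fun i => mul_le_mul_of_nonneg_right (le_abs_self K) (by positivity)) hK

theorem tendsto_mul_add_one_rpow_neg (hs : 0 < s) (K : ℝ) :
    Tendsto (fun i : ℕ => K * ((i : ℝ) + 1) ^ (-s)) atTop (𝓝 0) := by
  simpa only [mul_zero, Function.comp_def] using ((tendsto_rpow_neg_atTop hs).comp
    (tendsto_atTop_add_const_right _ 1 tendsto_natCast_atTop_atTop)).const_mul K

theorem antitone_mul_add_one_rpow_neg (hs : 0 ≤ s) {K : ℝ} (hK : 0 ≤ K) :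
    Antitone fun i : ℕ => K * ((i : ℝ) + 1) ^ (-s) := fun i j hij =>
  mul_le_mul_of_nonneg_left (Real.rpow_le_rpow_of_nonpos (by positivity)
    (add_le_add_left (Nat.cast_le.2 hij) 1) (neg_nonpos.2 hs)) hK

theorem span_besovBall (hs : 0 ≤ s) (hP : 0 < P) :
    (Submodule.span ℝ (besovBall b s P) : Set L2) = besovSpace b s := by
  rw [besovBall_eq_tailBall hs hP.le, span_tailBall fun i => by positivity]
  ext S
  rw [mem_besovSpace_iff hs]
  refine ⟨fun ⟨K, hK⟩ => ⟨K * √P, ?_⟩, fun ⟨K, hK⟩ => ⟨K / √P, ?_⟩⟩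
  · simpa only [Pi.smul_def, smul_eq_mul, mul_assoc] using hK
  · simpa only [Pi.smul_def, smul_eq_mul, ← mul_assoc, div_mul_cancel₀ K (Real.sqrt_ne_zero'.2 hP)]
      using hK

end Besov

section LogErrors

theorem ofReal_le_abs_log {x : ENNReal} {a : ℝ} (hx : x ≤ ENNReal.ofReal (Real.exp (-a))) :
    ENNReal.ofReal a ≤ (ENNReal.log x).abs := by
  have log_le : ENNReal.log x ≤ ((-a : ℝ) : EReal) := by
    simpa only [ENNReal.log_ofReal_of_pos (Real.exp_pos _), Real.log_exp]
      using ENNReal.log_le_log hx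
  induction hlog : ENNReal.log x with
  | bot => simp
  | top => simp [hlog] at log_le
  | coe y =>
    rw [hlog, EReal.coe_le_coe_iff] at log_le
    rw [EReal.abs_def]
    exact ENNReal.ofReal_le_ofReal ((le_neg_of_le_neg log_le).trans (neg_le_abs y))

theorem neg_le_log {x : ENNReal} {a : ℝ} (hx : ENNReal.ofReal (Real.exp (-a)) ≤ x) :
    ((-a : ℝ) : EReal) ≤ ENNReal.log x := by
  simpa only [ENNReal.log_ofReal_of_pos (Real.exp_pos _), Real.log_exp] using ENNReal.log_le_log hx

theorem abs_log_le {x : ENNReal} {a : ℝ} (hx : x ≤ 1) (hax : ENNReal.ofReal (Real.exp (-a)) ≤ x) :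
    (ENNReal.log x).abs ≤ ENNReal.ofReal a := by
  have le_log := neg_le_log hax
  have log_nonpos := ENNReal.log_le_zero_iff.2 hx
  induction hlog : ENNReal.log x with
  | bot => simp [hlog] at le_log
  | top => simp [hlog] at log_nonpos
  | coe y =>
    rw [hlog] at le_log log_nonpos
    rw [EReal.abs_def, abs_of_nonpos (EReal.coe_nonpos.1 log_nonpos)]
    exact ENNReal.ofReal_le_ofReal (neg_le.1 (EReal.coe_le_coe_iff.1 le_log))

variable {ι : Type*} {l : Filter ι} {R f : ι → ℝ} {x : ι → ENNReal}

theorem eventually_exp_lt_of_tendsto_log (hR : ∀ᶠ i in l, 0 < R i)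
    (hx : Tendsto (fun i => (((R i ^ 2)⁻¹ : ℝ) : EReal) * ENNReal.log (x i)) l (𝓝 0))
    {c : ℝ} (hc : 0 < c) : ∀ᶠ i in l, ENNReal.ofReal (Real.exp (-(c * R i ^ 2))) < x i := by
  have neg : ((-c : ℝ) : EReal) < 0 := EReal.coe_neg'.2 (neg_lt_zero.2 hc)
  filter_upwards [hR, hx.eventually (lt_mem_nhds neg)] with i hRi hxi
  by_contra! hle
  have log_le := ENNReal.log_le_log hle
  rw [ENNReal.log_ofReal_of_pos (Real.exp_pos _), Real.log_exp] at log_le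
  have mul_log_le := mul_le_mul_of_nonneg_left log_le
    (EReal.coe_nonneg.2 (inv_nonneg.2 (sq_nonneg (R i))))
  rw [← EReal.coe_mul, mul_neg, mul_left_comm, inv_mul_cancel₀ (by positivity), mul_one]
    at mul_log_le
  exact hxi.not_ge mul_log_le

theorem tendsto_mul_log_of_exp_le (hx : ∀ᶠ i in l, x i ≤ 1)
    (hfx : ∀ᶠ i in l, ENNReal.ofReal (Real.exp (-(f i))) ≤ x i)
    (hf : Tendsto (fun i => (R i ^ 2)⁻¹ * f i) l (𝓝 0)) :
    Tendsto (fun i => (((R i ^ 2)⁻¹ : ℝ) : EReal) * ENNReal.log (x i)) l (𝓝 0) := by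
  have inv_nonneg : ∀ i, (0 : EReal) ≤ ((R i ^ 2)⁻¹ : ℝ) := fun i =>
    EReal.coe_nonneg.2 (inv_nonneg.2 (sq_nonneg (R i)))
  have lower : Tendsto (fun i => (((R i ^ 2)⁻¹ * -f i : ℝ) : EReal)) l (𝓝 0) := by
    simpa only [mul_neg, neg_zero, EReal.coe_zero, Function.comp_def] using
      (continuous_coe_real_ereal.tendsto _).comp hf.neg
  refine tendsto_of_tendsto_of_tendsto_of_le_of_le' lower tendsto_const_nhds ?_ ?_
  · filter_upwards [hfx] with i hi
    rw [EReal.coe_mul]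
    exact mul_le_mul_of_nonneg_left (neg_le_log hi) (inv_nonneg i)
  · filter_upwards [hx] with i hi
    exact mul_nonpos_of_nonneg_of_nonpos (inv_nonneg i) (ENNReal.log_le_zero_iff.2 hi)

end LogErrors

section Errors

/-- The weights `ϰ²_{ε,j+1}`, numbered from `0` like the basis. -/
def weight (ϰ : ℝ → ℕ → ℝ) (ε : ℝ) (j : ℕ) : ℝ := ϰ ε (j + 1) ^ 2

/-- The Fourier coefficients `θ_{j+1} / ε` of the signal, in units of the noise level. -/
def signalShift (b : HilbertBasis ℕ ℝ L2) (ε : ℝ) (S : L2) (j : ℕ) : ℝ := inner ℝ (b j) S / ε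

variable {Ω : Type*} {W : L2 → Ω → ℝ} {ϰ : ℝ → ℕ → ℝ} {b : HilbertBasis ℕ ℝ L2} {ε : ℝ} {S : L2}

theorem signalShift_zero : signalShift b ε 0 = 0 :=
  funext fun j => by simp [signalShift]

theorem summable_sq_signalShift (b : HilbertBasis ℕ ℝ L2) (ε : ℝ) (S : L2) :
    Summable fun j => signalShift b ε S j ^ 2 := by
  simpa only [signalShift, div_pow] using (hasSum_inner_sq b S).summable.div_const (ε ^ 2)

theorem sqrt_bigA (ϰ : ℝ → ℕ → ℝ) (ε : ℝ) : √(bigA ϰ ε) = weightNorm (weight ϰ ε) / ε ^ 2 := by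
  have bigA_eq : bigA ϰ ε = (∑' j, weight ϰ ε j ^ 2) / (ε ^ 2) ^ 2 := by
    rw [bigA, div_eq_inv_mul, ← pow_mul]
    simp only [weight, ← pow_mul]
  rw [bigA_eq, Real.sqrt_div' _ (by positivity), Real.sqrt_sq (sq_nonneg ε), weightNorm]

theorem centeredChiSq_add_drift {a h : ℕ → ℝ} (ha : IsWeightSeq a) (hh : Summable fun j => h j ^ 2)
    (z : ℕ → ℝ) :
    centeredChiSq a h z + drift a h = ∑' j, a j * (z j + h j) ^ 2 - ∑' j, a j := by
  have mean : ∑' j, a j * (1 + h j ^ 2) = ∑' j, a j + drift a h := by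
    rw [drift, ← ha.summable.tsum_add (ha.summable_mul (fun _ => sq_nonneg _) hh)]
    simp only [mul_add, mul_one]
  rw [centeredChiSq, mean]
  ring

theorem neymanStat_eq (ha : IsWeightSeq (weight ϰ ε)) (hε : ε ≠ 0) (x : Ω) :
    neymanStat W b ϰ ε S x =
      centeredChiSq (weight ϰ ε) (signalShift b ε S) (fun j => W (b j) x) +
        drift (weight ϰ ε) (signalShift b ε S) := by
  rw [centeredChiSq_add_drift ha (summable_sq_signalShift b ε S), neymanStat, rhoSq,
    ← tsum_mul_left]
  congr 1
  refine tsum_congr fun j => ?_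
  simp only [weight, signalShift, observation]
  field_simp
  ring

theorem normalized_neymanStat_gt_iff (ha : IsWeightSeq (weight ϰ ε)) (hε : 0 < ε) (t : ℝ) (x : Ω) :
    (√(bigA ϰ ε))⁻¹ * neymanStat W b ϰ ε S x > t ↔
      t / ε ^ 2 * weightNorm (weight ϰ ε) <
        centeredChiSq (weight ϰ ε) (signalShift b ε S) (fun j => W (b j) x) +
          drift (weight ϰ ε) (signalShift b ε S) := by
  have hσ := ha.weightNorm_pos
  rw [neymanStat_eq ha hε.ne', sqrt_bigA, gt_iff_lt, lt_inv_mul_iff₀ (by positivity),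
    div_mul_eq_mul_div, div_mul_eq_mul_div, mul_comm t]

variable [MeasurableSpace Ω] {μ : Measure Ω}

theorem typeIError_eq (ha : IsWeightSeq (weight ϰ ε)) (hε : 0 < ε) (t : ℝ) :
    typeIError μ W b ϰ ε t = μ {x | t / ε ^ 2 * weightNorm (weight ϰ ε) <
      centeredChiSq (weight ϰ ε) 0 fun j => W (b j) x} := by
  have drift_zero : drift (weight ϰ ε) 0 = 0 := by simp [drift]
  simp only [typeIError, normalized_neymanStat_gt_iff ha hε, signalShift_zero, drift_zero, add_zero]

theorem typeIIError_eq (ha : IsWeightSeq (weight ϰ ε)) (hε : 0 < ε) (t : ℝ) :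
    typeIIError μ W b ϰ ε t S =
      μ {x | centeredChiSq (weight ϰ ε) (signalShift b ε S) (fun j => W (b j) x) +
        drift (weight ϰ ε) (signalShift b ε S) ≤ t / ε ^ 2 * weightNorm (weight ϰ ε)} := by
  simp only [typeIIError, normalized_neymanStat_gt_iff ha hε, not_lt]

namespace IsGaussianWhiteNoise

theorem isStdNormalSeq (hW : IsGaussianWhiteNoise μ W)
    (b : HilbertBasis ℕ ℝ L2) : IsStdNormalSeq (fun j => W (b j)) μ where
  indep := by
    have process : IsGaussianProcess (fun (p : (_ : ℕ) × Unit) x => W (b p.1) x) μ :=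
      hW.gaussian.comp_right fun p : (_ : ℕ) × Unit => b p.1
    have indep := IsGaussianProcess.iIndepFun_of_covariance_eq_zero
      (X := fun j (_ : Unit) => W (b j)) process (fun j _ => hW.gaussian.aemeasurable (b j))
      fun i j hij _ _ => (hW.covariance_eq (b i) (b j)).trans (b.orthonormal.2 hij)
    exact indep.comp (fun _ f => f ()) fun _ => measurable_pi_apply ()
  hasLaw j :=
    { aemeasurable := hW.gaussian.aemeasurable (b j)
      map_eq := by
        rw [(hW.gaussian.hasGaussianLaw_eval (b j)).map_eq_gaussianReal, hW.mean_zero,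
          ← covariance_self (hW.gaussian.aemeasurable (b j)), hW.covariance_eq,
          real_inner_self_eq_norm_sq, b.orthonormal.1 j]
        simp }

theorem typeIError_le (hW : IsGaussianWhiteNoise μ W) (ha : IsWeightSeq (weight ϰ ε)) (hε : 0 < ε)
    {t y : ℝ} (hy : 0 ≤ y) (hyt : y ≤ t / ε ^ 2)
    (hya : y * weight ϰ ε 0 ≤ weightNorm (weight ϰ ε)) :
    typeIError μ W b ϰ ε t ≤ ENNReal.ofReal (Real.exp (-(y ^ 2 / 16))) := by
  rw [typeIError_eq ha hε]
  refine (measure_mono fun x hx => ?_).trans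
    ((hW.isStdNormalSeq b).measure_lt_centeredChiSq_zero_le ha hy hya)
  exact (mul_le_mul_of_nonneg_right hyt ha.weightNorm_pos.le).trans_lt hx

theorem typeIIError_le (hW : IsGaussianWhiteNoise μ W) (ha : IsWeightSeq (weight ϰ ε)) (hε : 0 < ε)
    {t y : ℝ} (hy : 0 ≤ y) (hty : t / ε ^ 2 ≤ y / 4)
    (hya : y * weight ϰ ε 0 ≤ weightNorm (weight ϰ ε))
    (hyD : y * weightNorm (weight ϰ ε) ≤ drift (weight ϰ ε) (signalShift b ε S)) :
    typeIIError μ W b ϰ ε t S ≤ ENNReal.ofReal (Real.exp (-(y ^ 2 / 64))) := by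
  rw [typeIIError_eq ha hε]
  refine (measure_mono fun x hx => ?_).trans
    ((hW.isStdNormalSeq b).measure_centeredChiSq_add_drift_le_le ha
      (summable_sq_signalShift b ε S) hy hya hyD)
  exact le_trans hx (mul_le_mul_of_nonneg_right hty ha.weightNorm_pos.le)

theorem exp_le_typeIError (hW : IsGaussianWhiteNoise μ W) (ha : IsWeightSeq (weight ϰ ε))
    (hε : 0 < ε) {t : ℝ} (ht : 1 ≤ t) (hta : 16 * t * weight ϰ ε 0 ≤ weightNorm (weight ϰ ε)) :
    ENNReal.ofReal (Real.exp (-(58 * t ^ 2))) ≤ typeIError μ W b ϰ ε (t * ε ^ 2) := by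
  rw [typeIError_eq ha hε, mul_div_cancel_right₀ _ (by positivity)]
  exact (hW.isStdNormalSeq b).exp_le_measure_lt_centeredChiSq_zero ha ht hta

theorem exp_neg_one_le_typeIIError (hW : IsGaussianWhiteNoise μ W)
    (ha : IsWeightSeq (weight ϰ ε)) (hε : 0 < ε)
    (haσ : 4 * weight ϰ ε 0 ≤ weightNorm (weight ϰ ε)) :
    ENNReal.ofReal (Real.exp (-1)) ≤ typeIIError μ W b ϰ ε
      ((2 * (drift (weight ϰ ε) (signalShift b ε S) / weightNorm (weight ϰ ε)) + 5) * ε ^ 2) S := by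
  rw [typeIIError_eq ha hε, mul_div_cancel_right₀ _ (by positivity)]
  exact (hW.isStdNormalSeq b).exp_neg_one_le_measure_centeredChiSq_add_drift_le ha
    (summable_sq_signalShift b ε S) haσ

end IsGaussianWhiteNoise

end Errors

section Criteria

variable {Ω : Type*} [MeasurableSpace Ω] {μ : Measure Ω} {W : L2 → Ω → ℝ} {ϰ : ℝ → ℕ → ℝ}
  {b : HilbertBasis ℕ ℝ L2} {ι : Type*} {l : Filter ι} {ε : ι → ℝ} {S : ι → L2} {R : ι → ℝ}

/-- A critical value above a quarter of `c R σ` makes `log α` of order `-R²`, and one below it is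
exceeded under the alternative up to an event of probability `exp (-≍ R²)`. -/
theorem isLDConsistent_of_le_drift (hW : IsGaussianWhiteNoise μ W) (hε : ∀ᶠ i in l, 0 < ε i)
    (ha : ∀ᶠ i in l, IsWeightSeq (weight ϰ (ε i))) (hR : ∀ᶠ i in l, 0 < R i) {c : ℝ} (hc : 0 < c)
    (hD : ∀ᶠ i in l, c * R i * weightNorm (weight ϰ (ε i)) ≤
      drift (weight ϰ (ε i)) (signalShift b (ε i) (S i)))
    (hRa : ∀ᶠ i in l, c * R i * weight ϰ (ε i) 0 ≤ weightNorm (weight ϰ (ε i))) :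
    IsLDConsistent μ W b ϰ l ε S R := by
  intro t ht
  refine ⟨64 / c ^ 2, by positivity, ?_⟩
  filter_upwards [hε, ha, hR, hD, hRa,
    eventually_exp_lt_of_tendsto_log hR ht (show 0 < c ^ 2 / 256 by positivity)]
    with i hε ha hR hD hRa hα
  have hcR : 0 < c * R i := mul_pos hc hR
  have critical_le : t i / ε i ^ 2 ≤ c * R i / 4 := by
    by_contra! hlt
    refine hα.not_ge ((hW.typeIError_le ha hε (by positivity) hlt.le ?_).trans_eq ?_)
    · linarith [mul_nonneg hcR.le (ha.nonneg 0)]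
    · congr 3
      ring
  have hβ := ofReal_le_abs_log (hW.typeIIError_le ha hε hcR.le critical_le hRa hD)
  calc ENNReal.ofReal (R i ^ 2)
      = ENNReal.ofReal (64 / c ^ 2) * ENNReal.ofReal ((c * R i) ^ 2 / 64) := by
        rw [← ENNReal.ofReal_mul (by positivity)]
        congr 1
        field_simp
    _ ≤ _ := mul_le_mul_right hβ _

theorem isLDConsistent_of_isBigO_drift (hW : IsGaussianWhiteNoise μ W) (hε : ∀ᶠ i in l, 0 < ε i)
    (ha : ∀ᶠ i in l, IsWeightSeq (weight ϰ (ε i))) (hR : ∀ᶠ i in l, 0 < R i)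
    (hD : (fun i => R i * weightNorm (weight ϰ (ε i))) =O[l]
      fun i => drift (weight ϰ (ε i)) (signalShift b (ε i) (S i)))
    (hRa : (fun i => R i * weight ϰ (ε i) 0) =O[l] fun i => weightNorm (weight ϰ (ε i))) :
    IsLDConsistent μ W b ϰ l ε S R := by
  obtain ⟨C₁, hC₁, hD⟩ := hD.exists_pos
  obtain ⟨C₂, hC₂, hRa⟩ := hRa.exists_pos
  refine isLDConsistent_of_le_drift hW hε ha hR (c := (C₁ + C₂)⁻¹) (by positivity) ?_ ?_
  · filter_upwards [ha, hR, hD.bound] with i ha hR hD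
    have hσ := ha.weightNorm_pos
    have hD₀ := drift_nonneg ha.nonneg (signalShift b (ε i) (S i))
    rw [Real.norm_of_nonneg (by positivity), Real.norm_of_nonneg hD₀] at hD
    rw [mul_assoc, inv_mul_le_iff₀ (by positivity)]
    linarith [mul_nonneg hC₂.le hD₀]
  · filter_upwards [ha, hR, hRa.bound] with i ha hR hRa
    have hσ := ha.weightNorm_pos
    rw [Real.norm_of_nonneg (mul_nonneg hR.le (ha.nonneg 0)), Real.norm_of_nonneg hσ.le] at hRa
    rw [mul_assoc, inv_mul_le_iff₀ (by positivity)]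
    linarith [mul_pos hC₁ hσ]

theorem not_isLDConsistent_of_exp_le_errors [l.NeBot] [IsProbabilityMeasure μ]
    (hR : Tendsto R l atTop) {t f : ι → ℝ} {B : ℝ}
    (hf : Tendsto (fun i => (R i ^ 2)⁻¹ * f i) l (𝓝 0))
    (hα : ∀ᶠ i in l, ENNReal.ofReal (Real.exp (-(f i))) ≤ typeIError μ W b ϰ (ε i) (t i))
    (hβ : ∀ᶠ i in l, ENNReal.ofReal (Real.exp (-B)) ≤ typeIIError μ W b ϰ (ε i) (t i) (S i)) :
    ¬ IsLDConsistent μ W b ϰ l ε S R := by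
  intro consistent
  obtain ⟨C, hC, hR_le⟩ :=
    consistent t (tendsto_mul_log_of_exp_le (.of_forall fun _ => prob_le_one) hα hf)
  have hR_gt : ∀ᶠ i in l, C * |B| < R i ^ 2 :=
    ((tendsto_pow_atTop two_ne_zero).comp hR).eventually_gt_atTop _
  obtain ⟨i, hβ, hR_le, hR_gt⟩ := (hβ.and (hR_le.and hR_gt)).exists
  have abs_log : (ENNReal.log (typeIIError μ W b ϰ (ε i) (t i) (S i))).abs ≤ ENNReal.ofReal |B| :=
    (abs_log_le prob_le_one hβ).trans (ENNReal.ofReal_le_ofReal (le_abs_self B))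
  have := hR_le.trans (mul_le_mul_right abs_log _)
  rw [← ENNReal.ofReal_mul hC.le, ENNReal.ofReal_le_ofReal_iff (by positivity)] at this
  exact hR_gt.not_ge this

/-- With the critical value `2 D / σ + 5 = o(R)`, `log α = o(R²)` while `β` stays above `1 / e`. -/
theorem not_isLDConsistent_of_drift_isLittleO [l.NeBot] (hW : IsGaussianWhiteNoise μ W)
    (hε : ∀ᶠ i in l, 0 < ε i) (ha : ∀ᶠ i in l, IsWeightSeq (weight ϰ (ε i)))
    (hR : Tendsto R l atTop)
    (hD : (fun i => drift (weight ϰ (ε i)) (signalShift b (ε i) (S i))) =o[l]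
      fun i => R i * weightNorm (weight ϰ (ε i)))
    (hRa : (fun i => R i * weight ϰ (ε i) 0) =o[l] fun i => weightNorm (weight ϰ (ε i))) :
    ¬ IsLDConsistent μ W b ϰ l ε S R := by
  have := (hW.isStdNormalSeq b).isProbabilityMeasure
  set T : ι → ℝ := fun i => 2 * (drift (weight ϰ (ε i)) (signalShift b (ε i) (S i)) /
    weightNorm (weight ϰ (ε i))) + 5 with hT_def
  have hTR : T =o[l] R := by
    have ratio : (fun i => drift (weight ϰ (ε i)) (signalShift b (ε i) (S i)) /
        weightNorm (weight ϰ (ε i))) =o[l] R := by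
      refine (hD.mul_isBigO (isBigO_refl (fun i => (weightNorm (weight ϰ (ε i)))⁻¹) l)).congr'
        (.of_forall fun i => rfl) ?_
      filter_upwards [ha] with i ha
      exact mul_inv_cancel_right₀ ha.weightNorm_pos.ne' _
    exact (ratio.const_mul_left 2).add
      (isLittleO_const_left.2 (.inr (tendsto_norm_atTop_atTop.comp hR)))
  have five_le : ∀ᶠ i in l, 5 ≤ T i := by
    filter_upwards [ha] with i ha
    have := div_nonneg (drift_nonneg ha.nonneg (signalShift b (ε i) (S i))) ha.weightNorm_pos.le
    simp only [hT_def]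
    linarith
  have hTa : ∀ᶠ i in l, 16 * T i * weight ϰ (ε i) 0 ≤ weightNorm (weight ϰ (ε i)) := by
    filter_upwards [ha, five_le, hR.eventually_ge_atTop 0, hTR.bound one_pos,
      hRa.bound (show (0 : ℝ) < 1 / 16 by norm_num)] with i ha hT hR hTR hRa
    rw [Real.norm_of_nonneg (by linarith), Real.norm_of_nonneg hR, one_mul] at hTR
    rw [Real.norm_of_nonneg (mul_nonneg hR (ha.nonneg 0)),
      Real.norm_of_nonneg ha.weightNorm_pos.le] at hRa
    linarith [mul_le_mul_of_nonneg_right hTR (ha.nonneg 0)]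
  refine not_isLDConsistent_of_exp_le_errors hR (t := fun i => T i * ε i ^ 2)
    (f := fun i => 58 * T i ^ 2) (B := 1) ?_ ?_ ?_
  · simpa only [mul_zero, div_eq_inv_mul, mul_left_comm (58 : ℝ)] using
      (hTR.pow two_pos).tendsto_div_nhds_zero.const_mul 58
  · filter_upwards [hε, ha, five_le, hTa] with i hε ha hT hTa
    exact hW.exp_le_typeIError ha hε (by linarith) hTa
  · filter_upwards [hε, ha, five_le, hTa] with i hε ha hT hTa
    exact hW.exp_neg_one_le_typeIIError ha hε
      ((mul_le_mul_of_nonneg_right (by linarith) (ha.nonneg 0)).trans hTa)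

end Criteria

section EffectiveDimension

variable {ϰ : ℝ → ℕ → ℝ} {ε : ℝ}

theorem sum_Ico_one_eq_sum_weight (ϰ : ℝ → ℕ → ℝ) (ε : ℝ) (k : ℕ) :
    ∑ j ∈ Finset.Ico 1 k, ϰ ε j ^ 2 = ∑ j ∈ Finset.range (k - 1), weight ϰ ε j := by
  simp only [Finset.sum_Ico_eq_sum_range, weight, add_comm 1]

theorem kappaSq_nonneg (ϰ : ℝ → ℕ → ℝ) (ε : ℝ) : 0 ≤ kappaSq ϰ ε := sq_nonneg _

namespace IsWeightSeq

theorem isGreatest_kEps (ha : IsWeightSeq (weight ϰ ε)) :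
    IsGreatest {k : ℕ | ∑ j ∈ Finset.Ico 1 k, ϰ ε j ^ 2 ≤ rhoSq ϰ ε / 2} (kEps ϰ ε) := by
  have rhoSq_pos : 0 < rhoSq ϰ ε := ha.summable.tsum_pos ha.nonneg 0 ha.pos
  have nonempty : 0 ∈ {k : ℕ | ∑ j ∈ Finset.Ico 1 k, ϰ ε j ^ 2 ≤ rhoSq ϰ ε / 2} := by
    simpa using (half_pos rhoSq_pos).le
  obtain ⟨N, hN⟩ := (ha.summable.hasSum.tendsto_sum_nat.eventually
    (lt_mem_nhds (half_lt_self rhoSq_pos))).exists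
  have bddAbove : BddAbove {k : ℕ | ∑ j ∈ Finset.Ico 1 k, ϰ ε j ^ 2 ≤ rhoSq ϰ ε / 2} := by
    refine ⟨N, fun k hk => ?_⟩
    rw [Set.mem_ofPred_eq, sum_Ico_one_eq_sum_weight] at hk
    by_contra! hNk
    have sum_le := Finset.sum_le_sum_of_subset_of_nonneg (f := weight ϰ ε)
      (Finset.range_mono (show N ≤ k - 1 by omega)) fun j _ _ => ha.nonneg j
    exact (hN.trans_le sum_le).not_ge hk
  exact ⟨Nat.sSup_mem ⟨0, nonempty⟩ bddAbove, fun k hk => le_csSup bddAbove hk⟩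

theorem kEps_pos (ha : IsWeightSeq (weight ϰ ε)) : 0 < kEps ϰ ε := by
  have rhoSq_nonneg : 0 ≤ rhoSq ϰ ε := tsum_nonneg ha.nonneg
  exact ha.isGreatest_kEps.2 (show (1 : ℕ) ∈ _ by simpa using div_nonneg rhoSq_nonneg zero_le_two)

theorem rhoSq_lt (ha : IsWeightSeq (weight ϰ ε)) :
    rhoSq ϰ ε < 2 * ∑ j ∈ Finset.range (kEps ϰ ε), weight ϰ ε j := by
  by_contra! hle
  refine (Nat.lt_succ_self (kEps ϰ ε)).not_ge (ha.isGreatest_kEps.2 ?_)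
  rw [Set.mem_ofPred_eq, sum_Ico_one_eq_sum_weight, Nat.succ_sub_one]
  linarith

theorem kappaSq_eq (ha : IsWeightSeq (weight ϰ ε)) :
    kappaSq ϰ ε = weight ϰ ε (kEps ϰ ε - 1) := by
  rw [kappaSq, weight, Nat.sub_add_cancel ha.kEps_pos]

theorem sqrt_kEps_mul_kappaSq_le (ha : IsWeightSeq (weight ϰ ε)) :
    √(kEps ϰ ε) * kappaSq ϰ ε ≤ weightNorm (weight ϰ ε) := by
  apply Real.le_sqrt_of_sq_le
  rw [mul_pow, Real.sq_sqrt (Nat.cast_nonneg _)]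
  calc (kEps ϰ ε : ℝ) * kappaSq ϰ ε ^ 2
      = ∑ _j ∈ Finset.range (kEps ϰ ε), kappaSq ϰ ε ^ 2 := by simp
    _ ≤ ∑ j ∈ Finset.range (kEps ϰ ε), weight ϰ ε j ^ 2 := by
        refine Finset.sum_le_sum fun j hj => ?_
        have hj := Finset.mem_range.1 hj
        rw [ha.kappaSq_eq]
        exact pow_le_pow_left₀ (ha.nonneg _) (ha.antitone (by omega)) 2
    _ ≤ _ := ha.summable_sq.sum_le_tsum _ fun _ _ => sq_nonneg _

theorem weightNorm_le_sqrt_kEps_mul (ha : IsWeightSeq (weight ϰ ε)) :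
    weightNorm (weight ϰ ε) ≤ √2 * (√(kEps ϰ ε) * weight ϰ ε 0) := by
  have sum_le : ∑ j ∈ Finset.range (kEps ϰ ε), weight ϰ ε j ≤ kEps ϰ ε * weight ϰ ε 0 := by
    simpa using Finset.sum_le_sum fun j (_ : j ∈ Finset.range (kEps ϰ ε)) => ha.le_zero j
  have h₀ := ha.nonneg 0
  refine Real.sqrt_le_left (by positivity) |>.2 ?_
  calc ∑' j, weight ϰ ε j ^ 2
      ≤ ∑' j, weight ϰ ε 0 * weight ϰ ε j := ha.summable_sq.tsum_le_tsum
        (fun j => (sq _).trans_le (mul_le_mul_of_nonneg_right (ha.le_zero j) (ha.nonneg j)))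
        (ha.summable.mul_left _)
    _ = weight ϰ ε 0 * rhoSq ϰ ε := tsum_mul_left
    _ ≤ weight ϰ ε 0 * (2 * (kEps ϰ ε * weight ϰ ε 0)) := by gcongr; linarith [ha.rhoSq_lt]
    _ = (√2 * (√(kEps ϰ ε) * weight ϰ ε 0)) ^ 2 := by
        rw [mul_pow, mul_pow, Real.sq_sqrt zero_le_two, Real.sq_sqrt (Nat.cast_nonneg _)]
        ring

end IsWeightSeq

end EffectiveDimension

section RegularWeights

/-- The properties of the weights, as `ε → 0`, that decide LD consistency: `ϰ²_{εj}` is of order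
`ϰ_ε²` for `j ≤ c k_ε` and small compared with it once `j / k_ε` is large. -/
structure RegularWeights (ϰ : ℝ → ℕ → ℝ) : Prop where
  isWeightSeq : ∀ᶠ ε in 𝓝[>] 0, IsWeightSeq (weight ϰ ε)
  first_isBigO : (fun ε => weight ϰ ε 0) =O[𝓝[>] 0] kappaSq ϰ
  bulk_large : ∀ c > (1 : ℝ), ∃ C > 0, ∀ᶠ ε in 𝓝[>] 0, ∀ j : ℕ, (j : ℝ) + 1 ≤ c * kEps ϰ ε →
    C * kappaSq ϰ ε ≤ weight ϰ ε j
  tail_small : ∀ δ > (0 : ℝ), ∃ c > (1 : ℝ), ∀ᶠ ε in 𝓝[>] 0, ∀ j : ℕ, c * kEps ϰ ε ≤ (j : ℝ) + 1 →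
    weight ϰ ε j ≤ δ * kappaSq ϰ ε

variable {ϰ : ℝ → ℕ → ℝ} {ε : ℝ}

theorem WeightConditions.antitone_weight (hϰ : WeightConditions ϰ) (hε : 0 < ε) :
    Antitone (weight ϰ ε) :=
  antitone_nat_of_succ_le fun j => hϰ.A1 ε hε (j + 1) (Nat.le_add_left 1 j)

theorem WeightConditions.isWeightSeq (hϰ : WeightConditions ϰ) (hε : 0 < ε) :
    IsWeightSeq (weight ϰ ε) where
  antitone := hϰ.antitone_weight hε
  summable := hϰ.summable ε hε
  pos := by
    obtain ⟨C₁, hC₁, _, _, bounds⟩ := hϰ.A2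
    refine (sq_nonneg _).lt_of_ne' fun first_zero => ?_
    have weight_zero : ∀ j, ϰ ε (j + 1) = 0 := fun j =>
      sq_eq_zero_iff.1 <| le_antisymm
        ((hϰ.antitone_weight hε (Nat.zero_le j)).trans_eq first_zero) (sq_nonneg _)
    have bigA_zero : bigA ϰ ε = 0 := by simp [bigA, weight_zero]
    exact (hC₁.trans (bounds ε hε).1).ne' bigA_zero

theorem WeightConditions.regularWeights (hϰ : WeightConditions ϰ) : RegularWeights ϰ where
  isWeightSeq := eventually_mem_nhdsWithin.mono fun _ => hϰ.isWeightSeq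
  first_isBigO := hϰ.A4_first.1
  bulk_large c hc := by
    obtain ⟨C, hC, hle⟩ := hϰ.A4 c hc
    refine ⟨C, hC, eventually_mem_nhdsWithin.mono fun ε hε j hj => (hle ε hε).trans ?_⟩
    have j_lt : j + 1 ≤ ⌊c * (kEps ϰ ε : ℝ)⌋₊ := Nat.le_floor (by exact_mod_cast hj)
    have weight_le := (hϰ.isWeightSeq hε).antitone (Nat.le_sub_one_of_lt j_lt)
    rwa [weight, Nat.sub_add_cancel (by omega)] at weight_le
  tail_small δ hδ := by
    obtain ⟨C, _, lam, hlam, hlt⟩ := hϰ.A3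
    have decay : Tendsto (fun c : ℝ => C * c ^ (-lam)) atTop (𝓝 0) := by
      simpa only [mul_zero] using (tendsto_rpow_neg_atTop (one_pos.trans hlam)).const_mul C
    obtain ⟨c, hcδ, hc⟩ := ((decay.eventually (gt_mem_nhds hδ)).and (eventually_gt_atTop 1)).exists
    refine ⟨c, hc, eventually_mem_nhdsWithin.mono fun ε hε j hj => ?_⟩
    have ha := hϰ.isWeightSeq hε
    have floor_pos : 1 ≤ ⌊c * (kEps ϰ ε : ℝ)⌋₊ := by
      refine Nat.le_floor ?_
      exact_mod_cast one_le_mul_of_one_le_of_one_le hc.le (Nat.one_le_cast.2 ha.kEps_pos)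
    have floor_le : ⌊c * (kEps ϰ ε : ℝ)⌋₊ ≤ j + 1 := Nat.floor_le_of_le (by exact_mod_cast hj)
    have le_weight := ha.antitone (Nat.sub_le_of_le_add floor_le)
    rw [weight.eq_1 ϰ ε (_ - 1), Nat.sub_add_cancel floor_pos] at le_weight
    have A3 := hlt (c - 1) (sub_pos.2 hc) ε hε
    rw [add_sub_cancel] at A3
    exact (le_weight.trans A3.le).trans
      (mul_le_mul_of_nonneg_right hcδ.le (kappaSq_nonneg ϰ ε))

theorem kEps_rpow_isTheta {q : ℝ}
    (hk : (fun ε => (kEps ϰ ε : ℝ)) =Θ[𝓝[>] 0] fun ε : ℝ => ε ^ (-(2 * q))) (p : ℝ) :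
    (fun ε => (kEps ϰ ε : ℝ) ^ p) =Θ[𝓝[>] 0] fun ε : ℝ => ε ^ (-(2 * (q * p))) := by
  have nonneg : ∀ᶠ ε : ℝ in 𝓝[>] 0, 0 ≤ ε :=
    eventually_mem_nhdsWithin.mono fun _ hε => le_of_lt hε
  refine (hk.rpow (r := p) (.of_forall fun ε => Nat.cast_nonneg _)
    (nonneg.mono fun ε hε => Real.rpow_nonneg hε _)).trans_eventuallyEq (nonneg.mono fun ε hε => ?_)
  beta_reduce
  rw [← Real.rpow_mul hε, neg_mul, mul_assoc]

namespace RegularWeights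

theorem weightNorm_isTheta (hϰ : RegularWeights ϰ) :
    (fun ε => weightNorm (weight ϰ ε)) =Θ[𝓝[>] 0] fun ε => √(kEps ϰ ε) * kappaSq ϰ ε := by
  refine ⟨?_, .of_bound' ?_⟩
  · refine IsBigO.trans (.of_bound (√2) ?_) ((isBigO_refl _ _).mul hϰ.first_isBigO)
    filter_upwards [hϰ.isWeightSeq] with ε ha
    rw [Real.norm_of_nonneg ha.weightNorm_pos.le,
      Real.norm_of_nonneg (mul_nonneg (Real.sqrt_nonneg _) (ha.nonneg 0))]
    exact ha.weightNorm_le_sqrt_kEps_mul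
  · filter_upwards [hϰ.isWeightSeq] with ε ha
    rw [Real.norm_of_nonneg ha.weightNorm_pos.le,
      Real.norm_of_nonneg (mul_nonneg (Real.sqrt_nonneg _) (kappaSq_nonneg ϰ ε))]
    exact ha.sqrt_kEps_mul_kappaSq_le

variable {q r ω : ℝ}

theorem weightNorm_isTheta_rpow (hϰ : RegularWeights ϰ)
    (hk : (fun ε => (kEps ϰ ε : ℝ)) =Θ[𝓝[>] 0] fun ε : ℝ => ε ^ (-(2 * q))) :
    (fun ε => weightNorm (weight ϰ ε)) =Θ[𝓝[>] 0] fun ε : ℝ => ε ^ (-q) * kappaSq ϰ ε := by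
  have sqrt_kEps : (fun ε => √(kEps ϰ ε)) =Θ[𝓝[>] 0] fun ε : ℝ => ε ^ (-q) := by
    convert kEps_rpow_isTheta hk (1 / 2) using 2 with ε ε
    · exact Real.sqrt_eq_rpow _
    · congr 1
      ring
  exact hϰ.weightNorm_isTheta.trans (sqrt_kEps.mul (isTheta_refl _ _))

/-- With rate `ε^{-2ω}` the drift to be detected, `ε^{-2ω} σ_ε`, is that of a signal of norm
`ε^{2r}` seen through the weight `ϰ_ε²`. -/
theorem rate_mul_weightNorm_isTheta (hϰ : RegularWeights ϰ)
    (hk : (fun ε => (kEps ϰ ε : ℝ)) =Θ[𝓝[>] 0] fun ε : ℝ => ε ^ (-(2 * q)))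
    (hq : q = 2 - 4 * r - 2 * ω) :
    (fun ε => ε ^ (-(2 * ω)) * weightNorm (weight ϰ ε)) =Θ[𝓝[>] 0]
      fun ε : ℝ => kappaSq ϰ ε * (ε ^ (2 * r) / ε) ^ 2 := by
  refine ((isTheta_refl _ _).mul (hϰ.weightNorm_isTheta_rpow hk)).trans_eventuallyEq ?_
  refine eventually_mem_nhdsWithin.mono fun ε (hε : 0 < ε) => ?_
  have exponents : -(2 * ω) + -q = (2 * r - 1) * (2 : ℕ) := by
    push_cast
    linarith
  beta_reduce
  rw [← mul_assoc, ← Real.rpow_add hε, exponents, Real.rpow_mul_natCast hε.le,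
    Real.rpow_sub_one hε.ne', mul_comm]

theorem rate_mul_weight_zero_isLittleO (hϰ : RegularWeights ϰ)
    (hk : (fun ε => (kEps ϰ ε : ℝ)) =Θ[𝓝[>] 0] fun ε : ℝ => ε ^ (-(2 * q)))
    (hωq : 2 * ω < q) :
    (fun ε => ε ^ (-(2 * ω)) * weight ϰ ε 0) =o[𝓝[>] 0] fun ε => weightNorm (weight ϰ ε) := by
  have rate_lt : (fun ε : ℝ => ε ^ (-(2 * ω))) =o[𝓝[>] 0] fun ε : ℝ => ε ^ (-q) := by
    have pos : ∀ᶠ ε : ℝ in 𝓝[>] 0, 0 < ε := eventually_mem_nhdsWithin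
    refine (isLittleO_iff_tendsto' (pos.mono fun ε hε h => ?_)).2 ?_
    · exact absurd h (Real.rpow_pos_of_pos hε _).ne'
    · have exponent_pos : 0 < -(2 * ω) - -q := by linarith
      refine (((Real.continuousAt_rpow_const 0 _ (.inr exponent_pos.le)).tendsto.mono_left
        nhdsWithin_le_nhds).congr' (pos.mono fun ε hε => Real.rpow_sub hε _ _)).trans_eq ?_
      rw [Real.zero_rpow exponent_pos.ne']
  exact (rate_lt.mul_isBigO hϰ.first_isBigO).trans_isTheta (hϰ.weightNorm_isTheta_rpow hk).symm

end RegularWeights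

end RegularWeights

section Drift

variable {b : HilbertBasis ℕ ℝ L2} {ε : ℝ} {a : ℕ → ℝ}

theorem le_drift_signalShift (ha : IsWeightSeq a) (S : L2) {i : ℕ} {A : ℝ}
    (hA : ∀ j < i, A ≤ a j) :
    A / ε ^ 2 * (‖S‖ ^ 2 - ‖tail b i S‖ ^ 2) ≤ drift a (signalShift b ε S) := by
  refine hasSum_le (fun j => ?_) ((hasSum_head b i S).mul_left (A / ε ^ 2))
    (ha.summable_mul (fun _ => sq_nonneg _) (summable_sq_signalShift b ε S)).hasSum
  split_ifs with hij
  · simpa using mul_nonneg (ha.nonneg j) (sq_nonneg _)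
  · have := hA j (not_le.1 hij)
    rw [signalShift, div_pow, div_mul_eq_mul_div, ← mul_div_assoc]
    gcongr

theorem drift_signalShift_tail_le (ha : IsWeightSeq a) (S : L2) (i : ℕ) :
    drift a (signalShift b ε (tail b i S)) ≤ a i / ε ^ 2 * ‖tail b i S‖ ^ 2 := by
  refine hasSum_le (fun j => ?_)
    (ha.summable_mul (fun _ => sq_nonneg _) (summable_sq_signalShift b ε _)).hasSum
    ((hasSum_tail b i S).mul_left _)
  rw [signalShift, inner_tail]
  split_ifs with hij
  · have := ha.antitone hij
    rw [div_pow, div_mul_eq_mul_div, ← mul_div_assoc]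
    gcongr
  · simp

end Drift

namespace RegularWeights

variable {Ω : Type*} [MeasurableSpace Ω] {μ : Measure Ω} {W : L2 → Ω → ℝ} {ϰ : ℝ → ℕ → ℝ}
  {b : HilbertBasis ℕ ℝ L2} {ι : Type*} {l : Filter ι} {ε : ι → ℝ} {S : ι → L2}
  {i : ι → ℕ} {c C q r s ω : ℝ}

theorem kappaSq_mul_isBigO_drift (hϰ : RegularWeights ϰ) (hε : Tendsto ε l (𝓝[>] 0)) (hc : 1 < c)
    (hS : ∀ᶠ n in l, ‖tail b ⌊c * kEps ϰ (ε n)⌋₊ (S n)‖ ≤ ‖S n‖ / 2) :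
    (fun n => kappaSq ϰ (ε n) * (‖S n‖ / ε n) ^ 2) =O[l]
      fun n => drift (weight ϰ (ε n)) (signalShift b (ε n) (S n)) := by
  obtain ⟨C, hC, bulk⟩ := hϰ.bulk_large c hc
  refine .of_bound (4 / 3 / C) ?_
  filter_upwards [hε.eventually hϰ.isWeightSeq, hε.eventually bulk, hS] with n ha bulk hS
  have le_drift := le_drift_signalShift (b := b) (ε := ε n) ha (S n) fun j hj =>
    bulk j (by exact_mod_cast (Nat.le_floor_iff' (Nat.succ_ne_zero j)).1 hj)
  have energy : 3 / 4 * ‖S n‖ ^ 2 ≤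
      ‖S n‖ ^ 2 - ‖tail b ⌊c * kEps ϰ (ε n)⌋₊ (S n)‖ ^ 2 := by
    linarith [pow_le_pow_left₀ (norm_nonneg _) hS 2]
  have hκ := kappaSq_nonneg ϰ (ε n)
  rw [Real.norm_of_nonneg (by positivity), Real.norm_of_nonneg (drift_nonneg ha.nonneg _)]
  calc kappaSq ϰ (ε n) * (‖S n‖ / ε n) ^ 2
      = 4 / 3 / C * (C * kappaSq ϰ (ε n) / ε n ^ 2 * (3 / 4 * ‖S n‖ ^ 2)) := by
        field_simp
    _ ≤ 4 / 3 / C * drift (weight ϰ (ε n)) (signalShift b (ε n) (S n)) := by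
        refine mul_le_mul_of_nonneg_left (le_trans ?_ le_drift) (by positivity)
        gcongr

theorem drift_tail_isLittleO (hϰ : RegularWeights ϰ) (hε : Tendsto ε l (𝓝[>] 0))
    (hi : (fun n => (kEps ϰ (ε n) : ℝ)) =o[l] fun n => (i n : ℝ) + 1) :
    (fun n => drift (weight ϰ (ε n)) (signalShift b (ε n) (tail b (i n) (S n)))) =o[l]
      fun n => kappaSq ϰ (ε n) * (‖tail b (i n) (S n)‖ / ε n) ^ 2 := by
  refine .of_bound fun δ hδ => ?_
  obtain ⟨c, hc, small⟩ := hϰ.tail_small δ hδ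
  have hc₀ : 0 < c := one_pos.trans hc
  filter_upwards [hε.eventually hϰ.isWeightSeq, hε.eventually small, hi.bound (inv_pos.2 hc₀)]
    with n ha small hi
  rw [Real.norm_of_nonneg (by positivity), Real.norm_of_nonneg (by positivity),
    le_inv_mul_iff₀ hc₀] at hi
  have hκ := kappaSq_nonneg ϰ (ε n)
  rw [Real.norm_of_nonneg (drift_nonneg ha.nonneg _), Real.norm_of_nonneg (by positivity)]
  refine (drift_signalShift_tail_le ha (S n) (i n)).trans ?_
  rw [div_pow, ← mul_assoc, mul_div_assoc', div_mul_eq_mul_div]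
  gcongr
  exact small (i n) hi

theorem isLDConsistent_of_mem_tailBall (hϰ : RegularWeights ϰ) (hW : IsGaussianWhiteNoise μ W)
    (hε : Tendsto ε l (𝓝[>] 0)) (hq : q = 2 - 4 * r - 2 * ω) (hωq : 2 * ω < q) (hs : 0 < s)
    (hsq : q * s = r)
    (hk : (fun ε => (kEps ϰ ε : ℝ)) =Θ[𝓝[>] 0] fun ε : ℝ => ε ^ (-(2 * q)))
    (hS : ∀ᶠ n in l, S n ∈ tailBall b fun j => C * ((j : ℝ) + 1) ^ (-s))
    (hnorm : (fun n => ε n ^ (2 * r)) =O[l] fun n => ‖S n‖) :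
    IsLDConsistent μ W b ϰ l ε S fun n => ε n ^ (-(2 * ω)) := by
  have hε₀ : ∀ᶠ n in l, 0 < ε n := hε.eventually eventually_mem_nhdsWithin
  have kEps_pos : ∀ᶠ n in l, (0 : ℝ) < kEps ϰ (ε n) :=
    (hε.eventually hϰ.isWeightSeq).mono fun n ha => Nat.cast_pos.2 ha.kEps_pos
  have kEps_rpow : (fun n => (kEps ϰ (ε n) : ℝ) ^ (-s)) =O[l] fun n => ‖S n‖ := by
    have kEps_isBigO := (kEps_rpow_isTheta hk (-s)).1
    rw [mul_neg, hsq, mul_neg, neg_neg] at kEps_isBigO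
    exact (kEps_isBigO.comp_tendsto hε).trans hnorm
  obtain ⟨c, hc, tail_le⟩ := exists_norm_tail_le_half hs hS kEps_pos kEps_rpow
  refine isLDConsistent_of_isBigO_drift hW hε₀ (hε.eventually hϰ.isWeightSeq)
    (hε₀.mono fun n hε => Real.rpow_pos_of_pos hε _) ?_
    ((hϰ.rate_mul_weight_zero_isLittleO hk hωq).isBigO.comp_tendsto hε)
  calc (fun n => ε n ^ (-(2 * ω)) * weightNorm (weight ϰ (ε n)))
      =O[l] fun n => kappaSq ϰ (ε n) * (ε n ^ (2 * r) / ε n) ^ 2 :=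
        (hϰ.rate_mul_weightNorm_isTheta hk hq).1.comp_tendsto hε
    _ =O[l] fun n => kappaSq ϰ (ε n) * (‖S n‖ / ε n) ^ 2 :=
        (isBigO_refl _ _).mul ((hnorm.mul (isBigO_refl (fun n => (ε n)⁻¹) l)).pow 2)
    _ =O[l] _ := hϰ.kappaSq_mul_isBigO_drift hε hc tail_le

end RegularWeights

section Sequences

theorem isLittleO_of_tendsto_rpow_mul {ι : Type*} {l : Filter ι} {k m x : ι → ℝ} {s : ℝ}
    (hs : 0 < s) (hk : ∀ᶠ n in l, 0 ≤ k n) (hm : ∀ᶠ n in l, 0 ≤ m n) (hx : ∀ᶠ n in l, 0 < x n)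
    (hkx : (fun n => k n ^ s * x n) =O[l] fun _ => (1 : ℝ))
    (hmx : Tendsto (fun n => m n ^ s * x n) l atTop) : k =o[l] m := by
  have mul_x : (fun n => k n ^ s * x n) =o[l] fun n => m n ^ s * x n :=
    hkx.trans_isLittleO (isLittleO_const_left.2 (.inr (tendsto_norm_atTop_atTop.comp hmx)))
  have powers : (fun n => k n ^ s) =o[l] fun n => m n ^ s := by
    refine (mul_x.mul_isBigO (isBigO_refl (fun n => (x n)⁻¹) l)).congr' ?_ ?_ <;>
      exact hx.mono fun n hx => mul_inv_cancel_right₀ hx.ne' _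
  refine (powers.rpow (inv_pos.2 hs) (hm.mono fun n hm => Real.rpow_nonneg hm s)).congr' ?_ ?_
  · exact hk.mono fun n hk => Real.rpow_rpow_inv hk hs.ne'
  · exact hm.mono fun n hm => Real.rpow_rpow_inv hm hs.ne'

theorem rpow_ceil_rpow_neg_inv_mem_Icc {r x : ℝ} (hr : 0 < r) (hx : 0 < x) (hx₁ : x ≤ 1) :
    x ∈ Set.Icc ((⌈x ^ (-r⁻¹)⌉₊ : ℝ) ^ (-r)) (2 ^ r * (⌈x ^ (-r⁻¹)⌉₊ : ℝ) ^ (-r)) := by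
  have one_le : 1 ≤ x ^ (-r⁻¹) :=
    Real.one_le_rpow_of_pos_of_le_one_of_nonpos hx hx₁ (neg_nonpos.2 (inv_pos.2 hr).le)
  have le_ceil := Nat.le_ceil (x ^ (-r⁻¹))
  have ceil_le : (⌈x ^ (-r⁻¹)⌉₊ : ℝ) ≤ 2 * x ^ (-r⁻¹) := by
    linarith [Nat.ceil_lt_add_one (zero_le_one.trans one_le)]
  have rpow_rpow : (x ^ (-r⁻¹)) ^ (-r) = x := by
    rw [← Real.rpow_mul hx.le, neg_mul_neg, inv_mul_cancel₀ hr.ne', Real.rpow_one]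
  constructor
  · simpa only [rpow_rpow] using
      Real.rpow_le_rpow_of_nonpos (by positivity) le_ceil (neg_nonpos.2 hr.le)
  · have := Real.rpow_le_rpow_of_nonpos (by linarith) ceil_le (neg_nonpos.2 hr.le)
    rwa [Real.mul_rpow zero_le_two (by positivity), rpow_rpow, Real.rpow_neg zero_le_two,
      inv_mul_le_iff₀ (by positivity)] at this

theorem exists_tendsto_atTop_mem_Icc_rpow_neg {ι : Type*} {l : Filter ι} {r : ℝ} (hr : 0 < r)
    {x : ι → ℝ} (hx : ∀ n, 0 < x n) (hx₁ : ∀ n, x n ≤ 1) (hx₀ : Tendsto x l (𝓝 0)) :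
    ∃ j : ι → ℕ, Tendsto j l atTop ∧
      ∀ n, 0 < j n ∧ x n ∈ Set.Icc ((j n : ℝ) ^ (-r)) (2 ^ r * (j n : ℝ) ^ (-r)) := by
  refine ⟨fun n => ⌈x n ^ (-r⁻¹)⌉₊, ?_, fun n =>
    ⟨Nat.ceil_pos.2 (Real.rpow_pos_of_pos (hx n) _),
      rpow_ceil_rpow_neg_inv_mem_Icc hr (hx n) (hx₁ n)⟩⟩
  exact tendsto_nat_ceil_atTop.comp
    ((tendsto_rpow_neg_nhdsGT_zero (neg_lt_zero.2 (inv_pos.2 hr))).comp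
      (tendsto_nhdsWithin_iff.2 ⟨hx₀, .of_forall hx⟩))

variable {b : HilbertBasis ℕ ℝ L2} {s : ℝ} {S : L2}

theorem exists_large_norm_tail (hs : 0 ≤ s) (hS : S ∉ besovSpace b s) (n : ℕ) :
    ∃ i ≥ n, ‖tail b i S‖ ≤ 1 ∧ (n : ℝ) < ((i : ℝ) + 1) ^ s * ‖tail b i S‖ := by
  by_contra! bounded
  have eventually_le : ∀ᶠ i : ℕ in atTop, ((i : ℝ) + 1) ^ s * ‖tail b i S‖ ≤ n := by
    filter_upwards [eventually_ge_atTop n,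
      (tendsto_tail b S).norm.eventually (gt_mem_nhds (by simp : ‖(0 : L2)‖ < 1))] with i hi hi₁
    exact bounded i hi hi₁.le
  obtain ⟨K, hK⟩ := (isBoundedUnder_of_eventually_le eventually_le).bddAbove_range
  refine hS ((mem_besovSpace_iff hs).2 ⟨K, fun i => ?_⟩)
  have hi : (0 : ℝ) < (i : ℝ) + 1 := by positivity
  beta_reduce
  rw [Real.rpow_neg hi.le, ← div_eq_mul_inv, le_div_iff₀' (Real.rpow_pos_of_pos hi s)]
  exact hK ⟨i, rfl⟩

end Sequences

section Inconsistency

variable {Ω : Type*} [MeasurableSpace Ω] {μ : Measure Ω} {W : L2 → Ω → ℝ} {ϰ : ℝ → ℕ → ℝ}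
  {b : HilbertBasis ℕ ℝ L2} {q r s ω : ℝ}

theorem RegularWeights.not_isLDConsistent_tail {ι : Type*} {l : Filter ι} [l.NeBot] {ε : ι → ℝ}
    {S : ι → L2} {i : ι → ℕ} (hϰ : RegularWeights ϰ) (hW : IsGaussianWhiteNoise μ W)
    (hε : Tendsto ε l (𝓝[>] 0)) (hq : q = 2 - 4 * r - 2 * ω) (hω : 0 < ω) (hωq : 2 * ω < q)
    (hs : 0 < s) (hsq : q * s = r)
    (hk : (fun ε => (kEps ϰ ε : ℝ)) =Θ[𝓝[>] 0] fun ε : ℝ => ε ^ (-(2 * q)))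
    (hpos : ∀ᶠ n in l, 0 < ‖tail b (i n) (S n)‖)
    (hnorm : (fun n => ‖tail b (i n) (S n)‖) =O[l] fun n => ε n ^ (2 * r))
    (hlarge : Tendsto (fun n => ((i n : ℝ) + 1) ^ s * ‖tail b (i n) (S n)‖) l atTop) :
    ¬ IsLDConsistent μ W b ϰ l ε (fun n => tail b (i n) (S n)) fun n => ε n ^ (-(2 * ω)) := by
  have hε₀ : ∀ᶠ n in l, 0 < ε n := hε.eventually eventually_mem_nhdsWithin
  have kEps_isLittleO : (fun n => (kEps ϰ (ε n) : ℝ)) =o[l] fun n => (i n : ℝ) + 1 := by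
    refine isLittleO_of_tendsto_rpow_mul hs (.of_forall fun n => by positivity)
      (.of_forall fun n => by positivity) hpos ?_ hlarge
    have kEps_isBigO := (kEps_rpow_isTheta hk s).1
    rw [hsq] at kEps_isBigO
    refine ((kEps_isBigO.comp_tendsto hε).mul hnorm).congr' .rfl (hε₀.mono fun n hε => ?_)
    beta_reduce
    rw [Function.comp_apply, ← Real.rpow_add hε, neg_add_cancel, Real.rpow_zero]
  refine not_isLDConsistent_of_drift_isLittleO hW hε₀ (hε.eventually hϰ.isWeightSeq)
    ((tendsto_rpow_neg_nhdsGT_zero (by linarith)).comp hε) ?_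
    ((hϰ.rate_mul_weight_zero_isLittleO hk hωq).comp_tendsto hε)
  calc (fun n => drift (weight ϰ (ε n)) (signalShift b (ε n) (tail b (i n) (S n))))
      =o[l] fun n => kappaSq ϰ (ε n) * (‖tail b (i n) (S n)‖ / ε n) ^ 2 :=
        hϰ.drift_tail_isLittleO hε kEps_isLittleO
    _ =O[l] fun n => kappaSq ϰ (ε n) * (ε n ^ (2 * r) / ε n) ^ 2 :=
        (isBigO_refl _ _).mul ((hnorm.mul (isBigO_refl (fun n => (ε n)⁻¹) l)).pow 2)
    _ =O[l] fun n => ε n ^ (-(2 * ω)) * weightNorm (weight ϰ (ε n)) :=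
        (hϰ.rate_mul_weightNorm_isTheta hk hq).2.comp_tendsto hε

theorem RegularWeights.exists_not_isLDConsistent_tail (hϰ : RegularWeights ϰ)
    (hW : IsGaussianWhiteNoise μ W) (hq : q = 2 - 4 * r - 2 * ω) (hr : 0 < r) (hω : 0 < ω)
    (hωq : 2 * ω < q) (hs : 0 < s) (hsq : q * s = r)
    (hk : (fun ε => (kEps ϰ ε : ℝ)) =Θ[𝓝[>] 0] fun ε : ℝ => ε ^ (-(2 * q)))
    {S : L2} (hS : S ∉ besovSpace b s) :
    ∃ i j : ℕ → ℕ, Tendsto i atTop atTop ∧ Tendsto j atTop atTop ∧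
      (∃ c > 0, ∃ C > 0, ∀ n, c * (j n : ℝ) ^ (-r) < ‖tail b (i n) S‖ ∧
        ‖tail b (i n) S‖ < C * (j n : ℝ) ^ (-r)) ∧
      ¬ IsLDConsistent μ W b ϰ atTop (fun n => (j n : ℝ) ^ (-(1 / 2 : ℝ)))
        (fun n => tail b (i n) S) fun n => (j n : ℝ) ^ ω := by
  choose i le_i norm_le_one large using exists_large_norm_tail hs.le hS
  have hi : Tendsto i atTop atTop := tendsto_atTop_mono le_i tendsto_id
  have norm_pos : ∀ n, 0 < ‖tail b (i n) S‖ := fun n =>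
    pos_of_mul_pos_right ((Nat.cast_nonneg n).trans_lt (large n)) (by positivity)
  obtain ⟨j, hj, hj_mem⟩ := exists_tendsto_atTop_mem_Icc_rpow_neg hr norm_pos norm_le_one
    (by simpa using ((tendsto_tail b S).comp hi).norm)
  have j_pos : ∀ n, (0 : ℝ) < j n := fun n => Nat.cast_pos.2 (hj_mem n).1
  have hε : Tendsto (fun n => (j n : ℝ) ^ (-(1 / 2 : ℝ))) atTop (𝓝[>] 0) :=
    tendsto_nhdsWithin_iff.2
      ⟨(tendsto_rpow_neg_atTop one_half_pos).comp (tendsto_natCast_atTop_atTop.comp hj),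
        .of_forall fun n => Real.rpow_pos_of_pos (j_pos n) _⟩
  have rpow_ε : ∀ (n : ℕ) (p : ℝ),
      ((j n : ℝ) ^ (-(1 / 2 : ℝ))) ^ (2 * p) = (j n : ℝ) ^ (-p) := fun n p => by
    rw [← Real.rpow_mul (j_pos n).le]
    congr 1
    ring
  have norm_isBigO : (fun n => ‖tail b (i n) S‖) =O[atTop]
      fun n => ((j n : ℝ) ^ (-(1 / 2 : ℝ))) ^ (2 * r) := by
    refine .of_bound (2 ^ r) (.of_forall fun n => ?_)
    rw [rpow_ε, norm_norm, Real.norm_of_nonneg (Real.rpow_pos_of_pos (j_pos n) _).le]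
    exact (hj_mem n).2.2
  refine ⟨i, j, hi, hj, ⟨1 / 2, by norm_num, 2 ^ r + 1, by positivity, fun n => ?_⟩, ?_⟩
  · have := Real.rpow_pos_of_pos (j_pos n) (-r)
    constructor <;> linarith [(hj_mem n).2.1, (hj_mem n).2.2]
  · have not_consistent := hϰ.not_isLDConsistent_tail (S := fun _ => S) hW hε hq hω hωq hs hsq hk
      (.of_forall norm_pos) norm_isBigO
      (tendsto_atTop_mono (fun n => (large n).le) tendsto_natCast_atTop_atTop)
    simpa only [← mul_neg, rpow_ε, neg_neg] using not_consistent

end Inconsistency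

end SignalDetection

end

open SignalDetection in
theorem mainTheorem1_general {Ω : Type*} [MeasurableSpace Ω] {μ : Measure Ω} {W : L2 → Ω → ℝ}
    (hW : IsGaussianWhiteNoise μ W) {b : HilbertBasis ℕ ℝ L2} {ϰ : ℝ → ℕ → ℝ}
    (hϰ : RegularWeights ϰ) {r ω s : ℝ} (hr : 0 < r) (hω : 0 < 2 * ω) (hω' : 2 * ω < 1 - 2 * r)
    (hk : (fun ε => (kEps ϰ ε : ℝ)) =Θ[𝓝[>] 0] fun ε : ℝ => ε ^ (-4 + 8 * r + 4 * ω))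
    (hs : s = r / (2 - 4 * r - 2 * ω)) {P₀ : ℝ} (hP₀ : 0 < P₀) :
    IsMaxiset μ W b ϰ r ω (besovBall b s P₀) (besovSpace b s)
      (fun i => (√P₀ * ((i : ℝ) + 1) ^ (-s)) • b i) := by
  obtain ⟨q, hq⟩ : ∃ q, q = 2 - 4 * r - 2 * ω := ⟨_, rfl⟩
  have hωq : 2 * ω < q := by linarith
  have hq₀ : 0 < q := hω.trans hωq
  rw [← hq] at hs
  have hs₀ : 0 < s := hs ▸ div_pos hr hq₀
  have hsq : q * s = r := by rw [hs, mul_div_cancel₀ _ hq₀.ne']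
  rw [show -4 + 8 * r + 4 * ω = -(2 * q) by linarith] at hk
  have radius_pos (i : ℕ) : 0 < √P₀ * ((i : ℝ) + 1) ^ (-s) := by positivity
  have ball_eq := besovBall_eq_tailBall (b := b) hs₀.le hP₀.le
  refine ⟨ball_eq ▸ convex_tailBall, fun S hS => ?_,
    ball_eq ▸ isCompact_tailBall (tendsto_mul_add_one_rpow_neg hs₀ _), span_besovBall hs₀.le hP₀,
    ball_eq ▸ isGreedySystem_tailBall
      (antitone_mul_add_one_rpow_neg hs₀.le (Real.sqrt_nonneg _)) radius_pos,
    fun S hS hnorm => ?_, fun S hS => ?_⟩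
  · rw [ball_eq] at hS ⊢
    exact neg_mem_tailBall hS
  · rw [ball_eq] at hS
    exact hϰ.isLDConsistent_of_mem_tailBall hW tendsto_id hq hωq hs₀ hsq hk hS hnorm.2
  · simp only [greedyResidual_smul_basis fun i => (radius_pos i).ne']
    exact hϰ.exists_not_isLDConsistent_tail hW hq hr (by linarith) hωq hs₀ hsq hk hS

theorem mainTheorem1 {Ω : Type*} [MeasurableSpace Ω] (μ : Measure Ω)
    (W : SignalDetection.L2 → Ω → ℝ) (hW : SignalDetection.IsGaussianWhiteNoise μ W)
    (b : HilbertBasis ℕ ℝ SignalDetection.L2) (ϰ : ℝ → ℕ → ℝ)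
    (hϰ : SignalDetection.WeightConditions ϰ)
    (r ω s : ℝ) (hr : 0 < r) (hr' : r < 1 / 2) (hω : 0 < 2 * ω) (hω' : 2 * ω < 1 - 2 * r)
    (hk : (fun ε => (SignalDetection.kEps ϰ ε : ℝ)) =Θ[𝓝[>] 0]
      (fun ε : ℝ => ε ^ (-4 + 8 * r + 4 * ω)))
    (hs : s = r / (2 - 4 * r - 2 * ω)) (P₀ : ℝ) (hP₀ : 0 < P₀) :
    SignalDetection.IsMaxiset μ W b ϰ r ω
      (SignalDetection.besovBall b s P₀) (SignalDetection.besovSpace b s)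
      (fun i => (√P₀ * ((i : ℝ) + 1) ^ (-s)) • b i) :=
  mainTheorem1_general hW hϰ.regularWeights hr hω hω' hk hs hP₀
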